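/- Let $d\ge 1$, let $\Omega\subset\mathbb R^d$ be a nonempty bounded convex open set, let $T>0$ and $I=(0,T)$. Put $H=L_2(\Omega)$, $V=H^1_0(\Omega)$, let $V'$ be the dual of $V$, and let $A=-\Delta$ be the Dirichlet Laplacian, i.e. $D(A)=\{u\in V:\ \exists f\in H\ \forall v\in V:\ \int_\Omega\nabla u\cdot\nabla v\,dx=(f,v)_H\}$ and $Au:=f$; equip $D(A)$ with the norm $\|Au\|_H$. Let $\mathbb U=\mathcal H=L_2(I;H)$ and $$\mathcal C^2_T=\{v\in C^2([0,T];H)\cap C^1([0,T];V)\cap C([0,T];D(A)):\ v(T)=0,\ \dot v(T)=0\},\qquad B^*v=\ddot v+Av .$$ Let $\mathbb V\subset L_2(I;H)$ be the closure of $\mathcal C^2_T$ under $\|v\|_{\mathbb V}=\|B^*v\|_{L_2(I;H)}$: $v\in\mathbb V$ and $B^*v=\varphi$ mean that there are $v_n\in\mathcal C^2_T$ with $v_n\to v$ and $B^*v_n\to\varphi$ in $L_2(I;H)$. Then: 1. $B^*$ is well defined on $\mathbb V$, $\|\cdot\|_{\mathbb V}$ is a norm on $\mathbb V$, and $\mathbb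 V$ with $(v,w)_{\mathbb V}=(B^*v,B^*w)_{\mathcal H}$ is a Hilbert space. Every $v\in\mathbb V$ has exactly one representative in $C([0,T];V)\cap C^1([0,T];H)$. Hence, for $f\in L_2(I;V')$, $u_0\in H$, $u_1\in V'$, the expressions $$b(u,v)=(u,\ddot v+Av)_{\mathcal H}=(u,B^*v)_{\mathcal H},\qquad g(v)=\int_0^T\langle f(t),v(t)\rangle\,dt+\langle u_1,v(0)\rangle-(u_0,\dot v(0))_H$$ are defined for all $u\in\mathbb U$, $v\in\mathbb V$, where $\langle\cdot,\cdot\rangle$ is the duality pairing of $V'$ and $V$, and $v(t)$, $v(0)$ and $\dot v(0)$ in $g(v)$ are those of this representative. 2. For all $f\in L_2(I;V')$, $u_0\in H$, $u_1\in V'$ there is exactly one $u^*\in\mathbb U$ with $b(u^*,v)=g(v)$ for all $v\in\mathbb V$. 3. The inf-sup constant and the continuity constant are both equal to one: $$\inf_{0\ne u\in\mathbb U}\ \sup_{0\ne v\in\mathbb V}\frac{b(u,v)}{\|u\|_{\mathbb U}\|v\|_{\mathbb V}}=\sup_{0\ne u\in\mathbb U}\ \sup_{0\ne v\in\mathbb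 V}\frac{b(u,v)}{\|u\|_{\mathbb U}\|v\|_{\mathbb V}}=1 .$$ -/

import Mathlib

open MeasureTheory Set TopologicalSpace
open scoped InnerProductSpace ContDiff Distributions

noncomputable section

namespace WaveEq

/-- `ℝᵈ` with its Euclidean structure. -/
abbrev Space (d : ℕ) : Type := EuclideanSpace ℝ (Fin d)

/-! ### The spaces in the space variable and the Dirichlet Laplacian -/

/-- `H = L₂(Ω)`. -/
abbrev H {d : ℕ} (Ω : Opens (Space d)) : Type :=
  Lp ℝ 2 (volume.restrict (Ω : Set (Space d)))

/-- The vector fields in `L₂(Ω)ᵈ`. -/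
abbrev VecL2 {d : ℕ} (Ω : Opens (Space d)) : Type :=
  Lp (Space d) 2 (volume.restrict (Ω : Set (Space d)))

/-- The pairs `(φ, ∇φ)`, `φ ∈ C_c^∞(Ω)`, as elements of the Hilbert space `L₂(Ω) × L₂(Ω)ᵈ`. -/
def testPairs {d : ℕ} (Ω : Opens (Space d)) : Set (WithLp 2 (H Ω × VecL2 Ω)) :=
  {p | ∃ φ : 𝓓(Ω, ℝ),
    p.fst =ᵐ[volume.restrict (Ω : Set (Space d))] (fun x => φ x) ∧
    p.snd =ᵐ[volume.restrict (Ω : Set (Space d))] (fun x => gradient φ x)}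

/-- `H¹₀(Ω)`, the closure of `C_c^∞(Ω)` in the norm `(‖u‖² + ‖∇u‖²)^{1/2}`; its element `u` is stored
as the pair `(u, ∇u)`. The set `testPairs Ω` is already a linear subspace, taking the span only
bundles this fact. -/
def sobolevH10 {d : ℕ} (Ω : Opens (Space d)) : Submodule ℝ (WithLp 2 (H Ω × VecL2 Ω)) :=
  (Submodule.span ℝ (testPairs Ω)).topologicalClosure

/-- `V = H¹₀(Ω)` as a Hilbert space. -/
abbrev V {d : ℕ} (Ω : Opens (Space d)) : Type := sobolevH10 Ω

/-- The embedding `V ↪ H`. -/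
def toH {d : ℕ} (Ω : Opens (Space d)) : V Ω →L[ℝ] H Ω :=
  (WithLp.fstL 2 ℝ (H Ω) (VecL2 Ω)).comp (sobolevH10 Ω).subtypeL

/-- The weak gradient on `V`. -/
def grad {d : ℕ} (Ω : Opens (Space d)) : V Ω →L[ℝ] VecL2 Ω :=
  (WithLp.sndL 2 ℝ (H Ω) (VecL2 Ω)).comp (sobolevH10 Ω).subtypeL

/-- The Dirichlet form `a(u, v) = ∫_Ω ∇u · ∇v`. -/
def dirichletForm {d : ℕ} (Ω : Opens (Space d)) (u v : V Ω) : ℝ :=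
  ⟪grad Ω u, grad Ω v⟫_ℝ

/-- `L₂(Ω)` elements are determined by their products with the elements of `V`. -/
theorem eq_zero_of_inner_toH {d : ℕ} (Ω : Opens (Space d)) (f : H Ω)
    (hf : ∀ v : V Ω, ⟪f, toH Ω v⟫_ℝ = 0) : f = 0 := by
  have hloc : LocallyIntegrableOn f (Ω : Set (Space d)) volume := by
    rw [locallyIntegrableOn_iff Ω.isOpen.isLocallyClosed]
    intro K hK hKc
    have h1 : LocallyIntegrable f (volume.restrict (Ω : Set (Space d))) :=
      (Lp.memLp f).locallyIntegrable (by norm_num)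
    have h2 := h1.integrableOn_isCompact hKc
    rwa [IntegrableOn, Measure.restrict_restrict_of_subset hK] at h2
  have key := Ω.isOpen.ae_eq_zero_of_integral_contDiff_smul_eq_zero hloc (by
    intro g hg hgc hgs
    have hg1 : MemLp g 2 (volume.restrict (Ω : Set (Space d))) :=
      hg.continuous.memLp_of_hasCompactSupport hgc
    have hgrad : Continuous (gradient g) := by
      unfold gradient
      exact (LinearIsometryEquiv.continuous _).comp (hg.continuous_fderiv (by simp))
    have hgradc : HasCompactSupport (gradient g) := by
      have := hgc.fderiv (𝕜 := ℝ)
      exact this.comp_left (g := (InnerProductSpace.toDual ℝ (Space d)).symm) (by simp)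
    have hg2 : MemLp (gradient g) 2 (volume.restrict (Ω : Set (Space d))) :=
      hgrad.memLp_of_hasCompactSupport hgradc
    let p : WithLp 2 (H Ω × VecL2 Ω) := WithLp.toLp 2 (hg1.toLp g, hg2.toLp (gradient g))
    have hp : p ∈ sobolevH10 Ω :=
      Submodule.le_topologicalClosure _ (Submodule.subset_span
        ⟨⟨g, hg, hgc, hgs⟩, hg1.coeFn_toLp, hg2.coeFn_toLp⟩)
    have h0 := hf ⟨p, hp⟩
    have h1 : toH Ω ⟨p, hp⟩ = hg1.toLp g := rfl
    rw [h1, L2.inner_def] at h0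
    have h2 : ∫ x in (Ω : Set (Space d)), g x • f x = 0 := by
      rw [← h0]
      refine integral_congr_ae ?_
      filter_upwards [hg1.coeFn_toLp] with x hx
      rw [hx]
      simp
    rw [← h2]
    symm
    apply setIntegral_eq_integral_of_forall_compl_eq_zero
    intro x hx
    have : g x = 0 := by
      by_contra hne
      exact hx (hgs (subset_tsupport g hne))
    simp [this])
  rw [Lp.eq_zero_iff_ae_eq_zero]
  rw [Filter.EventuallyEq, ae_restrict_iff' Ω.isOpen.measurableSet]
  exact key

/-- `D(A) = {u ∈ V : ∃ f ∈ H, a(u, v) = (f, v)_H for all v ∈ V}`. -/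
def domainA {d : ℕ} (Ω : Opens (Space d)) : Submodule ℝ (V Ω) where
  carrier := {u | ∃ f : H Ω, ∀ v : V Ω, dirichletForm Ω u v = ⟪f, toH Ω v⟫_ℝ}
  add_mem' := by
    rintro u u' ⟨f, hf⟩ ⟨f', hf'⟩
    refine ⟨f + f', fun v => ?_⟩
    rw [inner_add_left, ← hf v, ← hf' v]
    simp [dirichletForm, inner_add_left]
  zero_mem' := ⟨0, fun v => by simp [dirichletForm]⟩
  smul_mem' := by
    rintro c u ⟨f, hf⟩
    refine ⟨c • f, fun v => ?_⟩
    rw [real_inner_smul_left, ← hf v]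
    simp [dirichletForm, real_inner_smul_left]

theorem eq_of_inner_toH {d : ℕ} (Ω : Opens (Space d)) (f f' : H Ω)
    (h : ∀ v : V Ω, ⟪f, toH Ω v⟫_ℝ = ⟪f', toH Ω v⟫_ℝ) : f = f' := by
  rw [← sub_eq_zero]
  refine eq_zero_of_inner_toH Ω _ fun v => ?_
  rw [inner_sub_left, h v, sub_self]

/-- The operator `A = -Δ : D(A) → H` with homogeneous Dirichlet conditions: `A u` is the `f ∈ H`
with `a(u, v) = (f, v)_H` for all `v ∈ V`. -/
def opA {d : ℕ} (Ω : Opens (Space d)) : domainA Ω →ₗ[ℝ] H Ω where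
  toFun u := u.2.choose
  map_add' u u' := by
    refine eq_of_inner_toH Ω _ _ fun v => ?_
    rw [inner_add_left, ← (u + u').2.choose_spec v, ← u.2.choose_spec v, ← u'.2.choose_spec v]
    simp [dirichletForm, inner_add_left]
  map_smul' c u := by
    refine eq_of_inner_toH Ω _ _ fun v => ?_
    rw [RingHom.id_apply, real_inner_smul_left, ← (c • u).2.choose_spec v, ← u.2.choose_spec v]
    simp [dirichletForm, real_inner_smul_left]

theorem inner_opA {d : ℕ} (Ω : Opens (Space d)) (u : domainA Ω) (v : V Ω) :
    ⟪opA Ω u, toH Ω v⟫_ℝ = dirichletForm Ω u v :=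
  (u.2.choose_spec v).symm

/-! ### Trial space, test space and the very weak form -/

/-- The Bochner space `L₂(I; X)`, `I = (0, T)`. -/
abbrev BochnerL2 (T : ℝ) (X : Type) [NormedAddCommGroup X] : Type :=
  Lp X 2 (volume.restrict (Ioo (0 : ℝ) T))

/-- The trial space `𝕌 = L₂(I; H)`. -/
abbrev TrialSpace {d : ℕ} (Ω : Opens (Space d)) (T : ℝ) : Type := BochnerL2 T (H Ω)

/-- The space `𝒞²_T` of all `v ∈ C²([0,T]; H) ∩ C¹([0,T]; V) ∩ C([0,T]; D(A))` with
`v(T) = 0` and `v'(T) = 0`. Only the values of `v` on `[0, T]` matter. Here `D(A)` carries the norm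
`‖A v‖_H`. -/
def classC2T {d : ℕ} (Ω : Opens (Space d)) (T : ℝ) : Submodule ℝ (ℝ → domainA Ω) where
  carrier := {v |
    ContDiffOn ℝ 2 (fun t => toH Ω (v t)) (Icc 0 T) ∧
    ContDiffOn ℝ 1 (fun t => (v t : V Ω)) (Icc 0 T) ∧
    ContinuousOn (fun t => opA Ω (v t)) (Icc 0 T) ∧
    v T = 0 ∧
    HasDerivWithinAt (fun t => (v t : V Ω)) 0 (Icc 0 T) T}
  add_mem' := by
    rintro v w ⟨h1, h2, h3, h4, h5⟩ ⟨k1, k2, k3, k4, k5⟩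
    refine ⟨?_, ?_, ?_, ?_, ?_⟩
    · simpa using h1.add k1
    · simpa using h2.add k2
    · refine (h3.add k3).congr fun t _ => ?_
      simp
    · simp [h4, k4]
    · have := h5.add k5
      rw [add_zero] at this
      exact this
  zero_mem' := by
    refine ⟨?_, ?_, ?_, ?_, ?_⟩
    · simpa using contDiffOn_const
    · simpa using contDiffOn_const
    · simpa using continuousOn_const
    · simp
    · simpa using hasDerivWithinAt_const T (Icc 0 T) (0 : V Ω)
  smul_mem' := by
    rintro c v ⟨h1, h2, h3, h4, h5⟩
    refine ⟨?_, ?_, ?_, ?_, ?_⟩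
    · simpa using h1.const_smul c
    · simpa using h2.const_smul c
    · refine (h3.const_smul c).congr fun t _ => ?_
      simp
    · simp [h4]
    · have := h5.const_smul c
      rw [smul_zero] at this
      exact this

/-- `B∘* v = v'' + A v`, with the classical time derivative in `H` on `[0, T]`. -/
def classicalB {d : ℕ} (Ω : Opens (Space d)) (T : ℝ) (v : ℝ → domainA Ω) (t : ℝ) : H Ω :=
  iteratedDerivWithin 2 (fun s => toH Ω (v s)) (Icc 0 T) t + opA Ω (v t)

/-- The graph of `B∘*` with domain `𝒞²_T`, as a subspace of `L₂(I; H) × L₂(I; H)`. -/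
def classicalGraph {d : ℕ} (Ω : Opens (Space d)) (T : ℝ) :
    Submodule ℝ (TrialSpace Ω T × TrialSpace Ω T) where
  carrier := {p | ∃ v ∈ classC2T Ω T,
    p.1 =ᵐ[volume.restrict (Ioo (0 : ℝ) T)] (fun t => toH Ω (v t)) ∧
    p.2 =ᵐ[volume.restrict (Ioo (0 : ℝ) T)] classicalB Ω T v}
  add_mem' := by
    rintro p q ⟨v, hv, h1, h2⟩ ⟨w, hw, k1, k2⟩
    refine ⟨v + w, add_mem hv hw, ?_, ?_⟩
    · filter_upwards [Lp.coeFn_add p.1 q.1, h1, k1] with t ht ht1 ht2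
      rw [Prod.fst_add, ht, Pi.add_apply, ht1, ht2, Pi.add_apply, Submodule.coe_add, map_add]
    · filter_upwards [Lp.coeFn_add p.2 q.2, h2, k2, ae_restrict_mem measurableSet_Ioo]
        with t ht ht1 ht2 htI
      have hT : (0 : ℝ) < T := htI.1.trans htI.2
      have htc : t ∈ Icc (0 : ℝ) T := Ioo_subset_Icc_self htI
      have := iteratedDerivWithin_fun_add htc (uniqueDiffOn_Icc hT) (hv.1 t htc) (hw.1 t htc)
      simp only [Prod.snd_add, ht, Pi.add_apply, ht1, ht2, classicalB, Submodule.coe_add, map_add]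
      rw [this]
      abel
  zero_mem' := by
    refine ⟨0, zero_mem _, ?_, ?_⟩
    · filter_upwards [Lp.coeFn_zero (H Ω) 2 (volume.restrict (Ioo (0 : ℝ) T))] with t ht
      rw [Prod.fst_zero, ht]
      simp
    · filter_upwards [Lp.coeFn_zero (H Ω) 2 (volume.restrict (Ioo (0 : ℝ) T))] with t ht
      rw [Prod.snd_zero, ht]
      simp [classicalB]
  smul_mem' := by
    rintro c p ⟨v, hv, h1, h2⟩
    refine ⟨c • v, Submodule.smul_mem _ c hv, ?_, ?_⟩
    · filter_upwards [Lp.coeFn_smul c p.1, h1] with t ht ht1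
      rw [Prod.smul_fst, ht, Pi.smul_apply, ht1, Pi.smul_apply, Submodule.coe_smul, map_smul]
    · filter_upwards [Lp.coeFn_smul c p.2, h2, ae_restrict_mem measurableSet_Ioo]
        with t ht ht1 htI
      have hT : (0 : ℝ) < T := htI.1.trans htI.2
      have htc : t ∈ Icc (0 : ℝ) T := Ioo_subset_Icc_self htI
      have := iteratedDerivWithin_fun_const_smul htc (uniqueDiffOn_Icc hT) c (hv.1 t htc)
      simp only [Prod.smul_snd, ht, Pi.smul_apply, ht1, classicalB, Submodule.coe_smul, map_smul,
        smul_add]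
      rw [this]

/-- The closure of the graph of `B∘*`: the pairs `(v, φ)` such that there are `vₙ ∈ 𝒞²_T` with
`vₙ → v` and `B∘* vₙ → φ` in `L₂(I; H)`. -/
def closedGraph {d : ℕ} (Ω : Opens (Space d)) (T : ℝ) :
    Submodule ℝ (TrialSpace Ω T × TrialSpace Ω T) :=
  (classicalGraph Ω T).topologicalClosure

/-- `B*`, the continuous extension of `B∘*`, as a partially defined operator on `L₂(I; H)`; its
graph is `closedGraph Ω T` as soon as the latter is the graph of an operator. -/
def opB {d : ℕ} (Ω : Opens (Space d)) (T : ℝ) : TrialSpace Ω T →ₗ.[ℝ] TrialSpace Ω T :=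
  (closedGraph Ω T).toLinearPMap

/-- The test space `𝕍 ⊆ L₂(I; H)`: the closure of `𝒞²_T` under `‖v‖_𝕍 = ‖B* v‖_{L₂(I; H)}`, i.e. the
`v ∈ L₂(I; H)` which are limits of sequences in `𝒞²_T` that are Cauchy for `‖·‖_𝕍`.
A type of its own, since its topology is not the one inherited from `L₂(I; H)`. -/
def TestSpace {d : ℕ} (Ω : Opens (Space d)) (T : ℝ) : Type := (opB Ω T).domain

namespace TestSpace

variable {d : ℕ} {Ω : Opens (Space d)} {T : ℝ}

instance : AddCommGroup (TestSpace Ω T) := inferInstanceAs (AddCommGroup (opB Ω T).domain)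

instance : Module ℝ (TestSpace Ω T) := inferInstanceAs (Module ℝ (opB Ω T).domain)

/-- The inclusion `𝕍 ⊆ L₂(I; H)`. -/
def incl : TestSpace Ω T →ₗ[ℝ] TrialSpace Ω T := (opB Ω T).domain.subtype

/-- `B* : 𝕍 → L₂(I; H)`. -/
def B : TestSpace Ω T →ₗ[ℝ] TrialSpace Ω T := (opB Ω T).toFun

/-- `‖v‖_𝕍 = ‖B* v‖_{L₂(I; H)}`. -/
instance : SeminormedAddCommGroup (TestSpace Ω T) :=
  SeminormedAddCommGroup.induced (TestSpace Ω T) (TrialSpace Ω T) (B (Ω := Ω) (T := T))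

/-- `(v, w)_𝕍 = (B* v, B* w)_{L₂(I; H)}`. -/
instance : InnerProductSpace ℝ (TestSpace Ω T) where
  norm_smul_le c v := by
    change ‖B (c • v)‖ ≤ ‖c‖ * ‖B v‖
    rw [map_smul, norm_smul]
  inner v w := ⟪B v, B w⟫_ℝ
  norm_sq_eq_re_inner v := by
    exact norm_sq_eq_re_inner (𝕜 := ℝ) (B v)
  conj_inner_symm v w := inner_conj_symm (𝕜 := ℝ) (B v) (B w)
  add_left u v w := by rw [map_add, inner_add_left]
  smul_left u v c := by
    rw [map_smul]
    exact real_inner_smul_left _ _ _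

theorem norm_def (v : TestSpace Ω T) : ‖v‖ = ‖B v‖ := rfl

theorem inner_def (v w : TestSpace Ω T) : ⟪v, w⟫_ℝ = ⟪B v, B w⟫_ℝ := rfl

end TestSpace

/-- The very weak form `b(u, v) = (u, v'' + A v)_{L₂(I; H)}` on `𝕌 × 𝕍`. -/
def formB {d : ℕ} {Ω : Opens (Space d)} {T : ℝ} (u : TrialSpace Ω T) (v : TestSpace Ω T) : ℝ :=
  ⟪u, TestSpace.B v⟫_ℝ

/-- `w ∈ C([0,T]; V) ∩ C¹([0,T]; H)` is a representative of `v ∈ L₂(I; H)`. Only the values of `w` on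
`[0, T]` matter. -/
structure IsRepresentative {d : ℕ} {Ω : Opens (Space d)} {T : ℝ} (w : ℝ → V Ω)
    (v : TrialSpace Ω T) : Prop where
  ae_eq : v =ᵐ[volume.restrict (Ioo (0 : ℝ) T)] (fun t => toH Ω (w t))
  continuousOn : ContinuousOn w (Icc 0 T)
  contDiffOn : ContDiffOn ℝ 1 (fun t => toH Ω (w t)) (Icc 0 T)

/-- The right-hand side `∫₀ᵀ ⟨f(t), w(t)⟩ dt + ⟨u₁, w(0)⟩ - (u₀, w'(0))_H` for
`w ∈ C([0,T]; V) ∩ C¹([0,T]; H)`. -/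
def rhs {d : ℕ} {Ω : Opens (Space d)} (T : ℝ) (f : BochnerL2 T (StrongDual ℝ (V Ω))) (u₀ : H Ω)
    (u₁ : StrongDual ℝ (V Ω)) (w : ℝ → V Ω) : ℝ :=
  (∫ t in Ioo (0 : ℝ) T, f t (w t)) + u₁ (w 0)
    - ⟪u₀, derivWithin (fun t => toH Ω (w t)) (Icc 0 T) 0⟫_ℝ

end WaveEq

end

/-! Everything rests on `B*` being an isometric bijection of `𝕍` onto `L₂(I; H)`. Once this is
known, the variational problem is the Riesz theorem: `g` is a bounded functional of `φ = B* v`, and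
`b(u, v) = (u, φ)`. Both constants are one by Cauchy-Schwarz, with equality when `B* v = u`.

Injectivity and continuity come from the energy estimate. Testing `v'' + A v = φ` with `v'` bounds
`v` in `C([0,T]; V)` and `v'` in `C([0,T]; H)` by `‖φ‖` (`energy_le`, `norm_stateMap_le`,
`norm_velocityMap_le`).

Surjectivity needs the range of the classical operator to be dense (`denseRange_classicalBMap`). No
spectral decomposition is used. With `J = (1 + A)⁻¹`, formally `A = J⁻¹ - 1 = ∑_{k ≥ 1} (1 - J)ᵏ`,
so the partial sums `Aₙ` are bounded positive operators. The problem `z'' + Aₙ z = χ` is a linear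
ODE in `H`, and `v = J² z` lies in `𝒞²_T` with `v'' + A v = J² χ + J (1 - J)ⁿ⁺¹ z`. The energy
estimate bounds `z` uniformly in `n`, and the last term is `O(n^{-1/2})` by `succ_mul_sq_norm_le`.
Thus the closure of the range contains every `η(t) J² h`, and these functions separate the points of
`L₂(I; H)`.

By density the maps from `φ` to `v` and `v'` extend to all of `L₂(I; H)`. The closed graph then
consists of the pairs `(S φ, φ)` with `S` the extended solution operator (`mem_closedGraph_iff`). It
is the graph of an operator because `S` is injective, which follows from the weak form of the
equation (`eq_zero_of_solution_eq_zero`). The extended state is the required representative, unique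
because `V → H` is injective (`toH_injective`). -/

noncomputable section

namespace WaveEq

/-! ### Linear evolution equations with a bounded generator -/

section Abstract

variable {X : Type*} [NormedAddCommGroup X]

/-- A linear differential equation with bounded generator is solvable on the whole line. -/
theorem exists_linear_ode_solution [NormedSpace ℝ X] [CompleteSpace X] (L : X →L[ℝ] X) {F : ℝ → X}
    (hF : Continuous F) (T : ℝ) :
    ∃ y : ℝ → X, (∀ t, HasDerivAt y (L (y t) + F t) t) ∧ y T = 0 := by
  let U : ℝ → X →L[ℝ] X := fun t => NormedSpace.exp (t • L)
  have hU : ∀ t, HasDerivAt U (L * U t) t := fun t => hasDerivAt_exp_smul_const' L t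
  have hUc : Continuous U := continuous_iff_continuousAt.2 fun t => (hU t).continuousAt
  have hinv : ∀ t, U t * U (-t) = 1 := by
    intro t
    have hc : Commute (t • L) (-t • L) := ((Commute.refl L).smul_left t).smul_right (-t)
    have := NormedSpace.exp_add_of_commute_of_mem_ball (𝕂 := ℝ) hc
      (by simp [NormedSpace.expSeries_radius_eq_top])
      (by simp [NormedSpace.expSeries_radius_eq_top])
    simpa [U] using this.symm
  -- Variation of constants: the solution is `U(t) ∫_T^t U(-s) F(s) ds`.
  let G : ℝ → X := fun s => U (-s) (F s)
  have hG : Continuous G := (hUc.comp continuous_neg).clm_apply hF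
  refine ⟨fun t => U t (∫ s in T..t, G s), fun t => ?_, by simp⟩
  have h1 : HasDerivAt (fun t => ∫ s in T..t, G s) (G t) t :=
    intervalIntegral.integral_hasDerivAt_right (hG.intervalIntegrable _ _)
      (hG.stronglyMeasurableAtFilter _ _) hG.continuousAt
  have h2 := (hU t).clm_apply h1
  have h3 : U t (G t) = F t := by
    change (U t * U (-t)) (F t) = F t
    rw [hinv]; rfl
  rw [h3] at h2
  exact h2

theorem exists_second_order_solution [NormedSpace ℝ X] [CompleteSpace X] (A : X →L[ℝ] X)
    {χ : ℝ → X} (hχ : Continuous χ) (T : ℝ) :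
    ∃ z p : ℝ → X, (∀ t, HasDerivAt z (p t) t) ∧ (∀ t, HasDerivAt p (χ t - A (z t)) t) ∧
      z T = 0 ∧ p T = 0 := by
  obtain ⟨y, hy, hyT⟩ := exists_linear_ode_solution
    ((ContinuousLinearMap.snd ℝ X X).prod (-(A.comp (ContinuousLinearMap.fst ℝ X X))))
    (F := fun t => ((0 : X), χ t)) (by fun_prop) T
  refine ⟨fun t => (y t).1, fun t => (y t).2, fun t => ?_, fun t => ?_, by simp [hyT], by simp [hyT]⟩
  · simpa using! (ContinuousLinearMap.fst ℝ X X).hasFDerivAt.comp_hasDerivAt t (hy t)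
  · have := (ContinuousLinearMap.snd ℝ X X).hasFDerivAt.comp_hasDerivAt t (hy t)
    simpa [sub_eq_neg_add, Function.comp_def] using this

/-! ### Energy estimates -/

variable [InnerProductSpace ℝ X]

/-- The energy estimate, `p` being the velocity, `N` the potential energy and `φ` the force. -/
theorem energy_le {T : ℝ} (hT : 0 < T) {p φ : ℝ → X} {N : ℝ → ℝ} (hp : ContinuousOn p (Icc 0 T))
    (hφ : ContinuousOn φ (Icc 0 T)) (hN : ∀ t ∈ Icc 0 T, 0 ≤ N t)
    (hE : ContinuousOn (fun t => ‖p t‖ ^ 2 + N t) (Icc 0 T))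
    (hd : ∀ t ∈ Ioo 0 T, HasDerivAt (fun t => ‖p t‖ ^ 2 + N t) (2 * ⟪p t, φ t⟫_ℝ) t)
    (hpT : p T = 0) (hNT : N T = 0) {t : ℝ} (ht : t ∈ Icc 0 T) :
    ‖p t‖ ^ 2 + N t ≤ 4 * T * ∫ s in Ioo 0 T, ‖φ s‖ ^ 2 := by
  obtain ⟨t₀, ht₀, hmax⟩ := isCompact_Icc.exists_isMaxOn ⟨0, left_mem_Icc.2 hT.le⟩ hp.norm
  set M := ‖p t₀‖
  have hM : ∀ s ∈ Icc 0 T, ‖p s‖ ≤ M := fun s hs => hmax hs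
  set R := ∫ s in Ioo 0 T, ‖φ s‖ ^ 2
  have hφ2 : IntegrableOn (fun s => ‖φ s‖ ^ 2) (Icc 0 T) := (hφ.norm.pow 2).integrableOn_Icc
  have key : ∀ t ∈ Icc 0 T, ‖p t‖ ^ 2 + N t ≤ M ^ 2 / 2 + 2 * T * R := by
    intro t ht
    have hsub : Icc t T ⊆ Icc 0 T := Icc_subset_Icc_left ht.1
    have hpc : ContinuousOn (fun s => 2 * ⟪p s, φ s⟫_ℝ) (Icc 0 T) :=
      continuousOn_const.mul (hp.inner hφ)
    have hint : IntervalIntegrable (fun s => 2 * ⟪p s, φ s⟫_ℝ) volume t T :=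
      (hpc.mono hsub).intervalIntegrable_of_Icc ht.2
    have h1 := intervalIntegral.integral_eq_sub_of_hasDerivAt_of_le ht.2 (hE.mono hsub)
      (fun x hx => hd x ⟨ht.1.trans_lt hx.1, hx.2⟩) hint
    have h2 : ‖p t‖ ^ 2 + N t = ∫ s in t..T, -(2 * ⟪p s, φ s⟫_ℝ) := by
      rw [intervalIntegral.integral_neg, h1, hpT, hNT]; simp
    -- Young's inequality, weighted so that the `M` term integrates over `(0, T)` to `M² / 2`, which
    -- can be absorbed.
    have hbd : ∀ s ∈ Icc 0 T, -(2 * ⟪p s, φ s⟫_ℝ) ≤ M ^ 2 / (2 * T) + 2 * T * ‖φ s‖ ^ 2 := by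
      intro s hs
      have h3 := abs_le.1 (abs_real_inner_le_norm (p s) (φ s))
      have h4 : ‖p s‖ * ‖φ s‖ ≤ M * ‖φ s‖ := by gcongr; exact hM s hs
      have h5 : 0 ≤ (M - 2 * T * ‖φ s‖) ^ 2 / (2 * T) := by positivity
      have h6 : (M - 2 * T * ‖φ s‖) ^ 2 / (2 * T)
          = M ^ 2 / (2 * T) + 2 * T * ‖φ s‖ ^ 2 - 2 * (M * ‖φ s‖) := by
        field_simp; ring
      linarith [h3.1]
    have hic : IntegrableOn (fun s => M ^ 2 / (2 * T) + 2 * T * ‖φ s‖ ^ 2) (Icc 0 T) :=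
      (integrable_const _).add (hφ2.const_mul _)
    rw [h2]
    calc ∫ s in t..T, -(2 * ⟪p s, φ s⟫_ℝ)
        ≤ ∫ s in t..T, (M ^ 2 / (2 * T) + 2 * T * ‖φ s‖ ^ 2) := by
          refine intervalIntegral.integral_mono_on ht.2 hint.neg ?_ fun s hs => hbd s (hsub hs)
          exact (intervalIntegrable_iff_integrableOn_Icc_of_le ht.2).2 (hic.mono_set hsub)
      _ ≤ ∫ s in (0 : ℝ)..T, (M ^ 2 / (2 * T) + 2 * T * ‖φ s‖ ^ 2) := by
          rw [intervalIntegral.integral_of_le ht.2, intervalIntegral.integral_of_le hT.le]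
          refine setIntegral_mono_set (hic.mono_set Ioc_subset_Icc_self) ?_
            (Ioc_subset_Ioc_left ht.1).eventuallyLE
          exact Filter.Eventually.of_forall fun s => by positivity
      _ = M ^ 2 / 2 + 2 * T * R := by
          have hi : IntegrableOn (fun s => ‖φ s‖ ^ 2) (Ioc 0 T) := hφ2.mono_set Ioc_subset_Icc_self
          rw [intervalIntegral.integral_add (by simp)
            ((intervalIntegrable_iff_integrableOn_Ioc_of_le hT.le).2 (hi.const_mul _)), intervalIntegral.integral_const,
            intervalIntegral.integral_const_mul, intervalIntegral.integral_of_le hT.le,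
            integral_Ioc_eq_integral_Ioo]
          change (T - 0) • (M ^ 2 / (2 * T)) + 2 * T * R = _
          simp only [sub_zero, smul_eq_mul]
          field_simp
  -- At the maximiser `t₀` the bound gives `M² ≤ 4TR`; inserted back at `t`, it gives `2TR + 2TR`.
  have h7 := key t₀ ht₀
  have h8 := hN t₀ ht₀
  have h9 := key t ht
  change M ^ 2 + N t₀ ≤ _ at h7
  linarith

/-- Bound of the solution of a homogeneous terminal value problem by its velocity. -/
theorem norm_le_of_velocity_le {Y : Type*} [NormedAddCommGroup Y] [NormedSpace ℝ Y] {T C : ℝ}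
    {z p : ℝ → Y} (hz : ∀ t ∈ Icc 0 T, HasDerivWithinAt z (p t) (Icc 0 T) t)
    (hp : ∀ t ∈ Icc 0 T, ‖p t‖ ≤ C) (hzT : z T = 0) {t : ℝ} (ht : t ∈ Icc 0 T) :
    ‖z t‖ ≤ C * T := by
  have h := (convex_Icc 0 T).norm_image_sub_le_of_norm_hasDerivWithin_le hz hp
    (right_mem_Icc.2 (ht.1.trans ht.2)) ht
  rw [hzT, sub_zero] at h
  have hC : 0 ≤ C := (norm_nonneg _).trans (hp t ht)
  refine h.trans (mul_le_mul_of_nonneg_left ?_ hC)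
  rw [Real.norm_eq_abs, abs_le]
  constructor <;> linarith [ht.1, ht.2]

/-- Induction in steps of two, since `Pᵏ⁺² = P Pᵏ P` is a conjugation of `Pᵏ` by the self-adjoint
`P`. -/
theorem _root_.ContinuousLinearMap.IsPositive.pow [CompleteSpace X] {P : X →L[ℝ] X}
    (hP : P.IsPositive) (k : ℕ) : (P ^ k).IsPositive := by
  induction k using Nat.twoStepInduction with
  | zero => simp
  | one => simpa using hP
  | more k ih _ =>
    have h := ih.conj_adjoint P
    rw [hP.isSelfAdjoint.adjoint_eq] at h
    have e : P ^ (k + 2) = P * (P ^ k * P) := by rw [← pow_succ, ← pow_succ']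
    rw [e]
    exact h

/-! ### Bounded approximation of an operator through its resolvent -/

section Resolvent

variable {J : X →L[ℝ] X}

theorem norm_apply_le_of_firmlyNonexpansive (hJ : ∀ x, ‖J x‖ ^ 2 ≤ ⟪J x, x⟫_ℝ) (x : X) :
    ‖J x‖ ≤ ‖x‖ := by
  have h1 := hJ x
  have h2 := real_inner_le_norm (J x) x
  by_contra! h
  nlinarith [norm_nonneg x]

theorem isPositive_one_sub (hs : J.IsPositive) (hJ : ∀ x, ‖J x‖ ^ 2 ≤ ⟪J x, x⟫_ℝ) :
    (1 - J).IsPositive := by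
  rw [ContinuousLinearMap.isPositive_iff]
  refine ⟨ContinuousLinearMap.isPositive_one.isSymmetric.sub hs.isSymmetric, fun x => ?_⟩
  have h1 := real_inner_le_norm (J x) x
  have h2 := norm_apply_le_of_firmlyNonexpansive hJ x
  have h3 : ‖J x‖ * ‖x‖ ≤ ‖x‖ * ‖x‖ := by gcongr
  simp only [sub_apply, one_apply_eq_self, inner_sub_left,
    real_inner_self_eq_norm_mul_norm]
  linarith

theorem sq_norm_one_sub_add_sq_norm_le (hJ : ∀ x, ‖J x‖ ^ 2 ≤ ⟪J x, x⟫_ℝ) (x : X) :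
    ‖(1 - J) x‖ ^ 2 + ‖J x‖ ^ 2 ≤ ‖x‖ ^ 2 := by
  have h : ‖(1 - J) x‖ ^ 2 = ‖x‖ ^ 2 - 2 * ⟪x, J x⟫_ℝ + ‖J x‖ ^ 2 := norm_sub_sq_real x (J x)
  have h1 := hJ x
  rw [real_inner_comm] at h1
  linarith

/-- The squares `‖J (1 - J)ᵏ x‖²` decrease in `k`, and by telescoping their sum is at most `‖x‖²`.
Hence the last of `n + 1` of them is at most their average. -/
theorem succ_mul_sq_norm_le (hJ : ∀ x, ‖J x‖ ^ 2 ≤ ⟪J x, x⟫_ℝ) (n : ℕ) (x : X) :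
    (n + 1) * ‖J (((1 - J) ^ n) x)‖ ^ 2 ≤ ‖x‖ ^ 2 := by
  have hcomm : ∀ y, J ((1 - J) y) = (1 - J) (J y) := fun y => by simp
  have hanti : Antitone fun k : ℕ => ‖J (((1 - J) ^ k) x)‖ ^ 2 := by
    refine antitone_nat_of_succ_le fun k => ?_
    have h := sq_norm_one_sub_add_sq_norm_le hJ (J (((1 - J) ^ k) x))
    rw [pow_succ' (1 - J), mul_apply_eq_comp, hcomm]
    nlinarith [sq_nonneg ‖J (J (((1 - J) ^ k) x))‖]
  have hsum : ∀ m : ℕ, ∑ k ∈ Finset.range m, ‖J (((1 - J) ^ k) x)‖ ^ 2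
      ≤ ‖x‖ ^ 2 - ‖((1 - J) ^ m) x‖ ^ 2 := by
    intro m
    induction m with
    | zero => simp
    | succ m ih =>
      have h := sq_norm_one_sub_add_sq_norm_le hJ (((1 - J) ^ m) x)
      rw [Finset.sum_range_succ, pow_succ' (1 - J), mul_apply_eq_comp]
      linarith
  have h1 : ∑ k ∈ Finset.range (n + 1), ‖J (((1 - J) ^ n) x)‖ ^ 2
      ≤ ∑ k ∈ Finset.range (n + 1), ‖J (((1 - J) ^ k) x)‖ ^ 2 :=
    Finset.sum_le_sum fun k hk => hanti (Nat.lt_succ_iff.1 (Finset.mem_range.1 hk))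
  have h2 := hsum (n + 1)
  rw [Finset.sum_const, Finset.card_range, nsmul_eq_mul] at h1
  rw [Nat.cast_succ] at h1
  nlinarith [sq_nonneg ‖((1 - J) ^ (n + 1)) x‖]

/-- If `J = (1 + A)⁻¹`, these bounded positive operators approximate `A`. -/
def approx (J : X →L[ℝ] X) (n : ℕ) : X →L[ℝ] X := ∑ k ∈ Finset.range n, (1 - J) ^ (k + 1)

theorem isPositive_approx [CompleteSpace X] (hs : J.IsPositive)
    (hJ : ∀ x, ‖J x‖ ^ 2 ≤ ⟪J x, x⟫_ℝ) (n : ℕ) : (approx J n).IsPositive :=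
  ContinuousLinearMap.isPositive_sum _ fun k _ => (isPositive_one_sub hs hJ).pow (k + 1)

/-- A geometric sum: each term telescopes through `J (1 - J)ᵏ = (1 - J)ᵏ - (1 - J)ᵏ⁺¹`. -/
theorem apply_approx (J : X →L[ℝ] X) (n : ℕ) (x : X) :
    J (approx J n x) = x - J x - ((1 - J) ^ (n + 1)) x := by
  induction n with
  | zero => simp [approx]
  | succ n ih =>
    have h : ∀ y, (1 - J) y = y - J y := fun y => rfl
    rw [approx, Finset.sum_range_succ, add_apply, map_add, ← approx, ih,
      pow_succ' _ (n + 1), mul_apply_eq_comp, h]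
    abel

/-- The energy estimate uses only the positivity of the approximating operator and not its norm, so
the bound on `z` does not depend on `n`. -/
theorem exists_approx_solution [CompleteSpace X] (hs : J.IsPositive)
    (hJ : ∀ x, ‖J x‖ ^ 2 ≤ ⟪J x, x⟫_ℝ) {χ : ℝ → X} (hχ : Continuous χ) {T : ℝ} (hT : 0 < T) (n : ℕ) :
    ∃ z p : ℝ → X, (∀ t, HasDerivAt z (p t) t) ∧ (∀ t, HasDerivAt p (χ t - approx J n (z t)) t) ∧
      z T = 0 ∧ p T = 0 ∧
      ∀ t ∈ Icc 0 T, ‖z t‖ ≤ √(4 * T * ∫ s in Ioo 0 T, ‖χ s‖ ^ 2) * T := by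
  obtain ⟨z, p, hz, hp, hzT, hpT⟩ := exists_second_order_solution (approx J n) hχ T
  have hA := isPositive_approx hs hJ n
  have hd : ∀ t, HasDerivAt (fun t => ‖p t‖ ^ 2 + ⟪approx J n (z t), z t⟫_ℝ)
      (2 * ⟪p t, χ t⟫_ℝ) t := by
    intro t
    have h1 := (hp t).norm_sq
    have h2 := (((approx J n).hasFDerivAt.comp_hasDerivAt t (hz t)).inner ℝ (hz t))
    refine (h1.add h2).congr_deriv ?_
    have h3 := hA.inner_left_eq_inner_right (p t) (z t)
    have h4 := real_inner_comm (p t) (approx J n (z t))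
    rw [inner_sub_right, h3, Function.comp_apply, h4]
    ring
  have hpc : Continuous p := continuous_iff_continuousAt.2 fun t => (hp t).continuousAt
  have hE : Continuous (fun t => ‖p t‖ ^ 2 + ⟪approx J n (z t), z t⟫_ℝ) :=
    continuous_iff_continuousAt.2 fun t => (hd t).continuousAt
  refine ⟨z, p, hz, hp, hzT, hpT, fun t ht =>
    norm_le_of_velocity_le (fun s _ => (hz s).hasDerivWithinAt) (fun s hs' => ?_) hzT ht⟩
  have h := energy_le hT hpc.continuousOn hχ.continuousOn
    (fun s _ => hA.inner_nonneg_left (z s)) hE.continuousOn (fun s _ => hd s) hpT (by simp [hzT]) hs'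
  exact Real.le_sqrt_of_sq_le ((le_add_of_nonneg_right (hA.inner_nonneg_left (z s))).trans h)

end Resolvent

/-! ### Separating points of `L₂(I; X)` -/

section TestFunctions

/-- An element of `L₂(I; X)` vanishes if it vanishes tested with `η(t) K h`, provided that the range
of `K` separates points. -/
theorem eq_zero_of_forall_test [CompleteSpace X] {T : ℝ}
    (u : Lp X 2 (volume.restrict (Ioo (0 : ℝ) T))) (K : X →L[ℝ] X)
    (hK : ∀ x, (∀ h, ⟪x, K h⟫_ℝ = 0) → x = 0)
    (hu : ∀ η : ℝ → ℝ, ContDiff ℝ ∞ η → HasCompactSupport η → tsupport η ⊆ Ioo 0 T →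
      ∀ h, ∫ t in Ioo 0 T, ⟪u t, η t • K h⟫_ℝ = 0) : u = 0 := by
  have hint : IntegrableOn u (Ioo 0 T) := (Lp.memLp u).integrable (by norm_num)
  have hint' : IntegrableOn (fun t => K.adjoint (u t)) (Ioo 0 T) :=
    (K.adjoint).integrable_comp hint
  -- The fundamental lemma of the calculus of variations is applied to `K* u`; pairing its
  -- vector-valued integral with `h` moves `K` onto the test function.
  have key := isOpen_Ioo.ae_eq_zero_of_integral_contDiff_smul_eq_zero
    (hint'.locallyIntegrableOn) (by
      intro η hη hηc hηs
      refine ext_inner_right ℝ fun h => ?_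
      have hi : Integrable (fun t => η t • K.adjoint (u t)) (volume.restrict (Ioo 0 T)) := by
        obtain ⟨C, hC⟩ := hη.continuous.bounded_above_of_compact_support hηc
        exact hint'.bdd_smul C hη.continuous.aestronglyMeasurable (Filter.Eventually.of_forall hC)
      have h1 : ∫ t, η t • K.adjoint (u t) = ∫ t in Ioo 0 T, η t • K.adjoint (u t) := by
        symm
        refine setIntegral_eq_integral_of_forall_compl_eq_zero fun t ht => ?_
        rw [image_eq_zero_of_notMem_tsupport fun h => ht (hηs h), zero_smul]
      rw [h1, inner_zero_left, real_inner_comm, ← integral_inner hi]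
      refine Eq.trans ?_ (hu η hη hηc hηs h)
      refine integral_congr_ae (Filter.Eventually.of_forall fun t => ?_)
      change ⟪h, η t • K.adjoint (u t)⟫_ℝ = ⟪u t, η t • K h⟫_ℝ
      rw [real_inner_smul_right, real_inner_smul_right, ContinuousLinearMap.adjoint_inner_right,
        real_inner_comm])
  rw [Lp.eq_zero_iff_ae_eq_zero, Filter.EventuallyEq, ae_restrict_iff' measurableSet_Ioo]
  filter_upwards [key] with t ht htI
  refine hK _ fun h => ?_
  rw [← ContinuousLinearMap.adjoint_inner_left, ht htI, inner_zero_left]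

end TestFunctions

end Abstract

/-! ### The space `H¹₀(Ω)` and the resolvent of the Dirichlet Laplacian -/

variable {d : ℕ} {Ω : Opens (Space d)}

instance : CompleteSpace (V Ω) :=
  inferInstanceAs (CompleteSpace (Submodule.span ℝ (testPairs Ω)).topologicalClosure)

theorem inner_eq_add_dirichletForm (u v : V Ω) :
    ⟪u, v⟫_ℝ = ⟪toH Ω u, toH Ω v⟫_ℝ + dirichletForm Ω u v := by
  rw [Submodule.coe_inner, WithLp.prod_inner_apply]
  rfl

theorem norm_sq_eq_add (u : V Ω) : ‖u‖ ^ 2 = ‖toH Ω u‖ ^ 2 + ‖grad Ω u‖ ^ 2 := by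
  rw [← real_inner_self_eq_norm_sq, inner_eq_add_dirichletForm, dirichletForm,
    real_inner_self_eq_norm_sq, real_inner_self_eq_norm_sq]

/-- Integration by parts for test pairs; both sides are continuous in the pair, so the identity
survives the closure that defines `H¹₀(Ω)`. It makes the stored second component a genuine weak
gradient. -/
theorem inner_grad_eq_neg_inner_toH {ψ : Space d → ℝ} (hψ : ContDiff ℝ ∞ ψ)
    (hψc : HasCompactSupport ψ) (hψΩ : tsupport ψ ⊆ Ω) (e : Space d) (v : V Ω) :
    ∫ x in (Ω : Set (Space d)), ⟪grad Ω v x, ψ x • e⟫_ℝ =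
      -∫ x in (Ω : Set (Space d)), ⟪toH Ω v x, fderiv ℝ ψ x e⟫_ℝ := by
  have hdψ : Continuous fun x => fderiv ℝ ψ x e :=
    (hψ.continuous_fderiv (by simp)).clm_apply continuous_const
  have hdψc : HasCompactSupport fun x => fderiv ℝ ψ x e := hψc.fderiv_apply (𝕜 := ℝ) e
  have h1 : MemLp (fun x => ψ x • e) 2 (volume.restrict (Ω : Set (Space d))) :=
    (hψ.continuous.smul continuous_const).memLp_of_hasCompactSupport hψc.smul_right
  have h2 : MemLp (fun x => fderiv ℝ ψ x e) 2 (volume.restrict (Ω : Set (Space d))) :=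
    hdψ.memLp_of_hasCompactSupport hdψc
  have r1 : ∀ w : VecL2 Ω, ⟪w, h1.toLp⟫_ℝ = ∫ x in (Ω : Set (Space d)), ⟪w x, ψ x • e⟫_ℝ := by
    intro w
    rw [L2.inner_def]
    refine integral_congr_ae ?_
    filter_upwards [h1.coeFn_toLp] with x hx
    rw [hx]
  have r2 : ∀ w : H Ω, ⟪w, h2.toLp⟫_ℝ
      = ∫ x in (Ω : Set (Space d)), ⟪w x, fderiv ℝ ψ x e⟫_ℝ := by
    intro w
    rw [L2.inner_def]
    refine integral_congr_ae ?_
    filter_upwards [h2.coeFn_toLp] with x hx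
    rw [hx]
  have key : ∀ p ∈ sobolevH10 Ω, ⟪p.snd, h1.toLp⟫_ℝ = -⟪p.fst, h2.toLp⟫_ℝ := by
    have hc : IsClosed {p : WithLp 2 (H Ω × VecL2 Ω) |
        ⟪p.snd, h1.toLp⟫_ℝ = -⟪p.fst, h2.toLp⟫_ℝ} := by
      refine isClosed_eq ?_ ?_
      · exact ((WithLp.sndL 2 ℝ (H Ω) (VecL2 Ω)).continuous).inner continuous_const
      · exact (((WithLp.fstL 2 ℝ (H Ω) (VecL2 Ω)).continuous).inner continuous_const).neg
    intro p hp
    refine closure_minimal (fun q hq => ?_) hc hp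
    change q ∈ Submodule.span ℝ (testPairs Ω) at hq
    change ⟪q.snd, h1.toLp⟫_ℝ = -⟪q.fst, h2.toLp⟫_ℝ
    induction hq using Submodule.span_induction with
    | zero => simp
    | add a b _ _ ha hb =>
      rw [WithLp.add_snd, WithLp.add_fst, inner_add_left, inner_add_left, ha, hb]; ring
    | smul c a _ ha =>
      rw [WithLp.smul_snd, WithLp.smul_fst, real_inner_smul_left, real_inner_smul_left, ha]; ring
    | mem q hq =>
      obtain ⟨φ, hφ1, hφ2⟩ := hq
      rw [r1, r2]
      have hφ : ContDiff ℝ ∞ φ := φ.contDiff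
      have hφc : HasCompactSupport φ := φ.hasCompactSupport
      have hdφ : Continuous fun x => fderiv ℝ φ x e :=
        (hφ.continuous_fderiv (by simp)).clm_apply continuous_const
      have ibp := integral_mul_fderiv_eq_neg_fderiv_mul_of_integrable (μ := volume)
        (f := ψ) (g := φ) (v := e)
        ((hdψ.mul hφ.continuous).integrable_of_hasCompactSupport hdψc.mul_right)
        ((hψ.continuous.mul hdφ).integrable_of_hasCompactSupport hψc.mul_right)
        ((hψ.continuous.mul hφ.continuous).integrable_of_hasCompactSupport hψc.mul_right)
        (fun x _ => hψ.differentiable (by simp) x) (fun x _ => hφ.differentiable (by simp) x)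
      have e1 : ∫ x in (Ω : Set (Space d)), ⟪q.snd x, ψ x • e⟫_ℝ
          = ∫ x, ψ x * fderiv ℝ φ x e := by
        rw [← setIntegral_eq_integral_of_forall_compl_eq_zero (s := (Ω : Set (Space d)))
          (f := fun x => ψ x * fderiv ℝ φ x e)]
        · refine integral_congr_ae ?_
          filter_upwards [hφ2] with x hx
          rw [hx, real_inner_smul_right, gradient, InnerProductSpace.toDual_symm_apply]
        · intro x hx
          rw [image_eq_zero_of_notMem_tsupport fun h => hx (hψΩ h), zero_mul]
      have e2 : ∫ x in (Ω : Set (Space d)), ⟪q.fst x, fderiv ℝ ψ x e⟫_ℝ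
          = ∫ x, fderiv ℝ ψ x e * φ x := by
        rw [← setIntegral_eq_integral_of_forall_compl_eq_zero (s := (Ω : Set (Space d)))
          (f := fun x => fderiv ℝ ψ x e * φ x)]
        · refine integral_congr_ae ?_
          filter_upwards [hφ1] with x hx
          rw [hx]
          simp
        · intro x hx
          rw [image_eq_zero_of_notMem_tsupport (f := φ) fun h => hx (φ.tsupport_subset h), mul_zero]
      rw [e1, e2, ibp]
  rw [← r1, ← r2]
  exact key v.1 v.2

/-- A function in `H¹₀(Ω)` is determined by its class in `L₂(Ω)`. -/
theorem toH_injective : Function.Injective (toH Ω) := by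
  refine (injective_iff_map_eq_zero _).2 fun v hv => ?_
  have hloc : LocallyIntegrableOn (grad Ω v) (Ω : Set (Space d)) volume := by
    rw [locallyIntegrableOn_iff Ω.isOpen.isLocallyClosed]
    intro K hK hKc
    have h1 : LocallyIntegrable (grad Ω v) (volume.restrict (Ω : Set (Space d))) :=
      (Lp.memLp _).locallyIntegrable (by norm_num)
    have h2 := h1.integrableOn_isCompact hKc
    rwa [IntegrableOn, Measure.restrict_restrict_of_subset hK] at h2
  -- A zero `L₂` class has zero weak gradient: after integration by parts, testing with `ψ e` leaves
  -- only the class itself.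
  have key := Ω.isOpen.ae_eq_zero_of_integral_contDiff_smul_eq_zero hloc (by
    intro ψ hψ hψc hψΩ
    have hi : Integrable (fun x => ψ x • grad Ω v x) (volume.restrict (Ω : Set (Space d))) := by
      have hψ2 : MemLp ψ 2 (volume.restrict (Ω : Set (Space d))) :=
        hψ.continuous.memLp_of_hasCompactSupport hψc
      exact memLp_one_iff_integrable.1 ((Lp.memLp (grad Ω v)).smul hψ2)
    rw [← setIntegral_eq_integral_of_forall_compl_eq_zero (s := (Ω : Set (Space d)))]
    · refine ext_inner_right ℝ fun e => ?_
      have h := inner_grad_eq_neg_inner_toH hψ hψc hψΩ e v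
      rw [hv] at h
      have h0 : ∫ x in (Ω : Set (Space d)), ⟪(0 : H Ω) x, fderiv ℝ ψ x e⟫_ℝ = 0 := by
        rw [← integral_zero (Space d) ℝ (μ := volume.restrict (Ω : Set (Space d)))]
        refine integral_congr_ae ?_
        filter_upwards [Lp.coeFn_zero ℝ 2 (volume.restrict (Ω : Set (Space d)))] with x hx
        rw [hx, Pi.zero_apply, inner_zero_left]
      rw [h0, neg_zero] at h
      rw [inner_zero_left, real_inner_comm, ← integral_inner hi, ← h]
      refine integral_congr_ae (Filter.Eventually.of_forall fun x => ?_)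
      change ⟪e, ψ x • grad Ω v x⟫_ℝ = ⟪grad Ω v x, ψ x • e⟫_ℝ
      rw [real_inner_smul_right, real_inner_smul_right, real_inner_comm]
    · intro x hx
      rw [image_eq_zero_of_notMem_tsupport fun h => hx (hψΩ h), zero_smul])
  have hg : grad Ω v = 0 := by
    rw [Lp.eq_zero_iff_ae_eq_zero, Filter.EventuallyEq, ae_restrict_iff' Ω.isOpen.measurableSet]
    exact key
  have h := norm_sq_eq_add v
  rw [hv, hg] at h
  simpa using h

/-- The resolvent `(1 + A)⁻¹` of the Dirichlet Laplacian on `H`. -/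
def resolvent (Ω : Opens (Space d)) : H Ω →L[ℝ] H Ω := (toH Ω).comp (toH Ω).adjoint

theorem isPositive_resolvent : (resolvent Ω).IsPositive :=
  ContinuousLinearMap.isPositive_self_comp_adjoint _

theorem norm_toH_le (v : V Ω) : ‖toH Ω v‖ ≤ ‖v‖ := by
  refine le_of_sq_le_sq ?_ (norm_nonneg _)
  rw [norm_sq_eq_add]
  exact le_add_of_nonneg_right (sq_nonneg _)

/-- With `i = toH Ω` one has `(i i* f, f) = ‖i* f‖²`, and `i` is a contraction. -/
theorem sq_norm_resolvent_le (f : H Ω) : ‖resolvent Ω f‖ ^ 2 ≤ ⟪resolvent Ω f, f⟫_ℝ := by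
  have h : ⟪resolvent Ω f, f⟫_ℝ = ‖(toH Ω).adjoint f‖ ^ 2 := by
    rw [← real_inner_self_eq_norm_sq, ContinuousLinearMap.adjoint_inner_right]
    rfl
  rw [h]
  exact pow_le_pow_left₀ (norm_nonneg _) (norm_toH_le _) 2

theorem eq_zero_of_inner_resolvent (f : H Ω) (hf : ∀ h, ⟪f, resolvent Ω h⟫_ℝ = 0) : f = 0 := by
  have h1 : (toH Ω).adjoint f = 0 := by
    rw [← norm_eq_zero, ← sq_eq_zero_iff, ← real_inner_self_eq_norm_sq,
      ContinuousLinearMap.adjoint_inner_left]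
    exact hf f
  refine eq_zero_of_inner_toH Ω f fun v => ?_
  rw [← ContinuousLinearMap.adjoint_inner_left, h1, inner_zero_left]

/-- The inner product of `V` is the full `H¹` one, so the adjoint of the embedding solves `u + A u =
h` weakly. -/
theorem dirichletForm_adjoint_toH (h : H Ω) (v : V Ω) :
    dirichletForm Ω ((toH Ω).adjoint h) v = ⟪h - resolvent Ω h, toH Ω v⟫_ℝ := by
  have h1 := inner_eq_add_dirichletForm ((toH Ω).adjoint h) v
  rw [ContinuousLinearMap.adjoint_inner_left] at h1
  rw [inner_sub_left, h1]
  simp [resolvent]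

/-- `(1 + A)⁻¹` as a map into the domain of `A`. -/
def resolventDomain (Ω : Opens (Space d)) (h : H Ω) : domainA Ω :=
  ⟨(toH Ω).adjoint h, h - resolvent Ω h, dirichletForm_adjoint_toH h⟩

theorem opA_resolventDomain (h : H Ω) : opA Ω (resolventDomain Ω h) = h - resolvent Ω h := by
  refine eq_of_inner_toH Ω _ _ fun v => ?_
  rw [inner_opA]
  exact dirichletForm_adjoint_toH h v

variable {T : ℝ}

/-! ### Derivatives and extensions of functions on `[0, T]` -/

section Calculus

variable {X : Type*} [NormedAddCommGroup X] [NormedSpace ℝ X]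

theorem iteratedDerivWithin_two_eq {f f' f'' : ℝ → X} (hT : 0 < T)
    (hf : ∀ t, HasDerivAt f (f' t) t) (hf' : ∀ t, HasDerivAt f' (f'' t) t) {t : ℝ}
    (ht : t ∈ Icc 0 T) : iteratedDerivWithin 2 f (Icc 0 T) t = f'' t := by
  have hu := uniqueDiffOn_Icc hT
  rw [iteratedDerivWithin_succ]
  have h1 : EqOn (iteratedDerivWithin 1 f (Icc 0 T)) f' (Icc 0 T) := fun s hs => by
    rw [iteratedDerivWithin_one]
    exact (hf s).hasDerivWithinAt.derivWithin (hu s hs)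
  rw [derivWithin_congr h1 (h1 ht)]
  exact (hf' t).hasDerivWithinAt.derivWithin (hu t ht)

theorem contDiff_one_of_hasDerivAt {f f' : ℝ → X} (hf : ∀ t, HasDerivAt f (f' t) t)
    (hc : Continuous f') : ContDiff ℝ 1 f := by
  rw [contDiff_one_iff_deriv]
  refine ⟨fun t => (hf t).differentiableAt, ?_⟩
  rwa [funext fun t => (hf t).deriv]

theorem contDiff_two_of_hasDerivAt {f f' f'' : ℝ → X} (hf : ∀ t, HasDerivAt f (f' t) t)
    (hf' : ∀ t, HasDerivAt f' (f'' t) t) (hc : Continuous f'') : ContDiff ℝ 2 f := by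
  rw [show (2 : WithTop ℕ∞) = 1 + 1 by norm_num, contDiff_succ_iff_deriv]
  refine ⟨fun t => (hf t).differentiableAt, by simp, ?_⟩
  rw [funext fun t => (hf t).deriv]
  exact contDiff_one_of_hasDerivAt hf' hc

end Calculus

section Extend

variable {X : Type*} [NormedAddCommGroup X]

/-- The extension of a continuous function on `[0, T]` by its boundary values. -/
def extendIcc (hT : 0 < T) (f : ℝ → X)
    (hf : ContinuousOn f (Icc 0 T)) : BoundedContinuousFunction ℝ X :=
  (BoundedContinuousFunction.mkOfCompact ⟨(Icc 0 T).domRestrict f, hf.domRestrict⟩).compContinuous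
    ⟨projIcc 0 T hT.le, continuous_projIcc⟩

theorem extendIcc_apply (hT : 0 < T) {f : ℝ → X} (hf : ContinuousOn f (Icc 0 T)) (t : ℝ) :
    extendIcc hT f hf t = f (projIcc 0 T hT.le t) := rfl

theorem extendIcc_apply_of_mem (hT : 0 < T) {f : ℝ → X} (hf : ContinuousOn f (Icc 0 T)) {t : ℝ}
    (ht : t ∈ Icc 0 T) : extendIcc hT f hf t = f t := by
  rw [extendIcc_apply, projIcc_of_mem hT.le ht]

end Extend

/-! ### The energy estimate on `𝒞²_T` -/

section ClassC2T

variable {v : ℝ → domainA Ω}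

theorem hasDerivWithinAt_toH (hv : v ∈ classC2T Ω T) {t : ℝ} (ht : t ∈ Icc 0 T) :
    HasDerivWithinAt (fun t => toH Ω (v t)) (derivWithin (fun t => toH Ω (v t)) (Icc 0 T) t)
      (Icc 0 T) t :=
  (hv.1.differentiableOn (by simp) t ht).hasDerivWithinAt

theorem hasDerivWithinAt_velocity (hT : 0 < T) (hv : v ∈ classC2T Ω T) {t : ℝ}
    (ht : t ∈ Icc 0 T) :
    HasDerivWithinAt (derivWithin (fun t => toH Ω (v t)) (Icc 0 T))
      (iteratedDerivWithin 2 (fun t => toH Ω (v t)) (Icc 0 T) t) (Icc 0 T) t := by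
  have h := hv.1.differentiableOn_iteratedDerivWithin (m := 1) (by norm_num)
    (uniqueDiffOn_Icc hT) t ht
  have h2 := h.hasDerivWithinAt
  rw [← iteratedDerivWithin_succ] at h2
  refine h2.congr (fun s _ => ?_) ?_ <;> rw [iteratedDerivWithin_one]

theorem continuousOn_velocity (hT : 0 < T) (hv : v ∈ classC2T Ω T) :
    ContinuousOn (derivWithin (fun t => toH Ω (v t)) (Icc 0 T)) (Icc 0 T) :=
  fun _ ht => (hasDerivWithinAt_velocity hT hv ht).continuousWithinAt

theorem continuousOn_classicalB (hT : 0 < T) (hv : v ∈ classC2T Ω T) :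
    ContinuousOn (classicalB Ω T v) (Icc 0 T) :=
  (hv.1.continuousOn_iteratedDerivWithin (by norm_num) (uniqueDiffOn_Icc hT)).add hv.2.2.1

theorem velocity_eq_toH (hT : 0 < T) (hv : v ∈ classC2T Ω T) {t : ℝ} (ht : t ∈ Icc 0 T) :
    derivWithin (fun t => toH Ω (v t)) (Icc 0 T) t
      = toH Ω (derivWithin (fun t => (v t : V Ω)) (Icc 0 T) t) := by
  have h := (hv.2.1.differentiableOn (by simp) t ht).hasDerivWithinAt
  exact ((toH Ω).hasFDerivAt.comp_hasDerivWithinAt t h).derivWithin (uniqueDiffOn_Icc hT t ht)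

theorem velocity_terminal (hT : 0 < T) (hv : v ∈ classC2T Ω T) :
    derivWithin (fun t => toH Ω (v t)) (Icc 0 T) T = 0 := by
  have hm : T ∈ Icc 0 T := right_mem_Icc.2 hT.le
  rw [velocity_eq_toH hT hv hm, hv.2.2.2.2.derivWithin (uniqueDiffOn_Icc hT T hm), map_zero]

/-- Since `v ∈ C¹([0,T]; V)`, the velocity is an admissible test element in `(A v, v')_H = a(v,
v')`, half the derivative of the potential energy. -/
theorem energy_le_of_mem_classC2T (hT : 0 < T) (hv : v ∈ classC2T Ω T) {t : ℝ}
    (ht : t ∈ Icc 0 T) :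
    ‖derivWithin (fun t => toH Ω (v t)) (Icc 0 T) t‖ ^ 2 + ‖grad Ω (v t)‖ ^ 2
      ≤ 4 * T * ∫ s in Ioo 0 T, ‖classicalB Ω T v s‖ ^ 2 := by
  have hvc : ContinuousOn (fun t => (v t : V Ω)) (Icc 0 T) := hv.2.1.continuousOn
  refine energy_le hT (p := derivWithin (fun t => toH Ω (v t)) (Icc 0 T))
    (N := fun t => ‖grad Ω (v t)‖ ^ 2) (continuousOn_velocity hT hv)
    (continuousOn_classicalB hT hv) (fun _ _ => sq_nonneg _) ?_ ?_ (velocity_terminal hT hv)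
    ?_ ht
  · exact ((continuousOn_velocity hT hv).norm.pow 2).add
      (((grad Ω).continuous.comp_continuousOn hvc).norm.pow 2)
  · intro s hs
    have hsI := Ioo_subset_Icc_self hs
    have hn : Icc 0 T ∈ nhds s := Icc_mem_nhds hs.1 hs.2
    have h1 := ((hasDerivWithinAt_velocity hT hv hsI).hasDerivAt hn).norm_sq
    have h2 := ((hv.2.1.differentiableOn (by simp) s hsI).hasDerivWithinAt).hasDerivAt hn
    have h3 := ((grad Ω).hasFDerivAt.comp_hasDerivAt s h2).norm_sq
    refine (h1.add h3).congr_deriv ?_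
    have h4 := inner_opA Ω (v s) (derivWithin (fun t => (v t : V Ω)) (Icc 0 T) s)
    rw [← velocity_eq_toH hT hv hsI] at h4
    rw [classicalB, inner_add_right, real_inner_comm (opA Ω (v s)), h4]
    simp only [Function.comp_apply, dirichletForm]
    ring
  · simp [hv.2.2.2.1]

end ClassC2T

/-! ### State, velocity and force as linear maps, bounded by the norm of the force -/

section LinearMaps

variable (Ω)

/-- `v ↦ v` on `𝒞²_T`, with values in `C([0,T]; V)`. -/
def stateMap (hT : 0 < T) : classC2T Ω T →ₗ[ℝ] BoundedContinuousFunction ℝ (V Ω) where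
  toFun v := extendIcc hT (fun t => (v.1 t : V Ω)) v.2.2.1.continuousOn
  map_add' _ _ := by ext1 t; rfl
  map_smul' _ _ := by ext1 t; rfl

/-- `v ↦ v'` on `𝒞²_T`, with values in `C([0,T]; H)`. -/
def velocityMap (hT : 0 < T) : classC2T Ω T →ₗ[ℝ] BoundedContinuousFunction ℝ (H Ω) where
  toFun v := extendIcc hT _ (continuousOn_velocity hT v.2)
  map_add' v w := by
    ext1 t
    have ht : (projIcc 0 T hT.le t : ℝ) ∈ Icc 0 T := (projIcc 0 T hT.le t).2
    have := (hasDerivWithinAt_toH v.2 ht).add (hasDerivWithinAt_toH w.2 ht)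
    simp only [BoundedContinuousFunction.add_apply, extendIcc_apply]
    rw [← this.derivWithin (uniqueDiffOn_Icc hT _ ht)]
    refine congrArg (fun f => derivWithin f (Icc 0 T) _) (funext fun s => ?_)
    simp
  map_smul' c v := by
    ext1 t
    have ht : (projIcc 0 T hT.le t : ℝ) ∈ Icc 0 T := (projIcc 0 T hT.le t).2
    have := (hasDerivWithinAt_toH v.2 ht).const_smul c
    simp only [BoundedContinuousFunction.smul_apply, RingHom.id_apply, extendIcc_apply]
    rw [← this.derivWithin (uniqueDiffOn_Icc hT _ ht)]
    refine congrArg (fun f => derivWithin f (Icc 0 T) _) (funext fun s => ?_)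
    simp

/-- `v ↦ v'' + A v` on `𝒞²_T`, with values in `C([0,T]; H)`. -/
def forceMap (hT : 0 < T) : classC2T Ω T →ₗ[ℝ] BoundedContinuousFunction ℝ (H Ω) where
  toFun v := extendIcc hT _ (continuousOn_classicalB hT v.2)
  map_add' v w := by
    ext1 t
    have ht : (projIcc 0 T hT.le t : ℝ) ∈ Icc 0 T := (projIcc 0 T hT.le t).2
    have := iteratedDerivWithin_fun_add ht (uniqueDiffOn_Icc hT) (v.2.1 _ ht) (w.2.1 _ ht)
    simp only [BoundedContinuousFunction.add_apply, extendIcc_apply, classicalB,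
      Submodule.coe_add, Pi.add_apply, map_add]
    rw [this]
    abel
  map_smul' c v := by
    ext1 t
    have ht : (projIcc 0 T hT.le t : ℝ) ∈ Icc 0 T := (projIcc 0 T hT.le t).2
    have := iteratedDerivWithin_fun_const_smul ht (uniqueDiffOn_Icc hT) c (v.2.1 _ ht)
    simp only [BoundedContinuousFunction.smul_apply, RingHom.id_apply, extendIcc_apply, classicalB,
      Submodule.coe_smul, Pi.smul_apply, map_smul, smul_add]
    rw [this]

/-- The class in `L₂(I; X)` of a bounded continuous function. -/
abbrev toBochner (T : ℝ) (X : Type) [NormedAddCommGroup X] [NormedSpace ℝ X] :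
    BoundedContinuousFunction ℝ X →L[ℝ] BochnerL2 T X :=
  BoundedContinuousFunction.toLp 2 (volume.restrict (Ioo (0 : ℝ) T)) ℝ

/-- `B∘*` as a map into `L₂(I; H)`. -/
def classicalBMap (hT : 0 < T) : classC2T Ω T →ₗ[ℝ] TrialSpace Ω T :=
  (toBochner T (H Ω)).toLinearMap ∘ₗ forceMap Ω hT

variable {Ω}

theorem coeFn_classicalBMap (hT : 0 < T) (v : classC2T Ω T) :
    classicalBMap Ω hT v =ᵐ[volume.restrict (Ioo (0 : ℝ) T)] classicalB Ω T v.1 := by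
  have h := BoundedContinuousFunction.coeFn_toLp (p := 2) (volume.restrict (Ioo (0 : ℝ) T)) ℝ
    (forceMap Ω hT v)
  filter_upwards [h, ae_restrict_mem measurableSet_Ioo] with t ht htI
  exact ht.trans
    (extendIcc_apply_of_mem hT (continuousOn_classicalB hT v.2) (Ioo_subset_Icc_self htI))

theorem integral_sq_classicalB (hT : 0 < T) (v : classC2T Ω T) :
    ∫ s in Ioo 0 T, ‖classicalB Ω T v.1 s‖ ^ 2 = ‖classicalBMap Ω hT v‖ ^ 2 := by
  rw [← real_inner_self_eq_norm_sq, L2.inner_def]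
  refine integral_congr_ae ?_
  filter_upwards [coeFn_classicalBMap hT v] with t ht
  rw [ht, real_inner_self_eq_norm_sq]

theorem energy_le_classicalBMap (hT : 0 < T) (v : classC2T Ω T) {t : ℝ} (ht : t ∈ Icc 0 T) :
    ‖derivWithin (fun t => toH Ω (v.1 t)) (Icc 0 T) t‖ ^ 2 + ‖grad Ω (v.1 t)‖ ^ 2
      ≤ 4 * T * ‖classicalBMap Ω hT v‖ ^ 2 := by
  rw [← integral_sq_classicalB hT]
  exact energy_le_of_mem_classC2T hT v.2 ht

theorem velocity_le (hT : 0 < T) (v : classC2T Ω T) {t : ℝ} (ht : t ∈ Icc 0 T) :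
    ‖derivWithin (fun t => toH Ω (v.1 t)) (Icc 0 T) t‖
      ≤ √(4 * T) * ‖classicalBMap Ω hT v‖ := by
  refine le_of_sq_le_sq ?_ (by positivity)
  rw [mul_pow, Real.sq_sqrt (by positivity)]
  exact (le_add_of_nonneg_right (sq_nonneg _)).trans (energy_le_classicalBMap hT v ht)

theorem norm_velocityMap_le (hT : 0 < T) (v : classC2T Ω T) :
    ‖velocityMap Ω hT v‖ ≤ √(4 * T) * ‖classicalBMap Ω hT v‖ :=
  (BoundedContinuousFunction.norm_le (by positivity)).2 fun t =>
    velocity_le hT v (projIcc 0 T hT.le t).2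

/-- The gradient part is the energy estimate. The `L₂` part comes from integrating the velocity back
from `T`, which gives the term `4T · T²` without a Poincaré inequality. -/
theorem norm_stateMap_le (hT : 0 < T) (v : classC2T Ω T) :
    ‖stateMap Ω hT v‖ ≤ √(4 * T * T ^ 2 + 4 * T) * ‖classicalBMap Ω hT v‖ := by
  refine (BoundedContinuousFunction.norm_le (by positivity)).2 fun t => ?_
  have ht : (projIcc 0 T hT.le t : ℝ) ∈ Icc 0 T := (projIcc 0 T hT.le t).2
  refine le_of_sq_le_sq ?_ (by positivity)
  change ‖(v.1 (projIcc 0 T hT.le t) : V Ω)‖ ^ 2 ≤ _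
  rw [norm_sq_eq_add, mul_pow, Real.sq_sqrt (by positivity), add_mul]
  have h1 := norm_le_of_velocity_le (fun s hs => hasDerivWithinAt_toH v.2 hs)
    (fun s hs => velocity_le hT v hs) (by simp [v.2.2.2.2.1]) ht
  have h2 := pow_le_pow_left₀ (norm_nonneg _) h1 2
  rw [mul_pow, mul_pow, Real.sq_sqrt (by positivity)] at h2
  have h3 := energy_le_classicalBMap hT v ht
  have h4 := sq_nonneg ‖derivWithin (fun t => toH Ω (v.1 t)) (Icc 0 T) (projIcc 0 T hT.le t)‖
  linarith

theorem mem_classicalGraph_iff (hT : 0 < T) (q : TrialSpace Ω T × TrialSpace Ω T) :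
    q ∈ classicalGraph Ω T ↔ ∃ v : classC2T Ω T,
      q = (toBochner T (H Ω) ((toH Ω).compLeftContinuousBounded ℝ (stateMap Ω hT v)),
        classicalBMap Ω hT v) := by
  have hs : ∀ v : classC2T Ω T,
      toBochner T (H Ω) ((toH Ω).compLeftContinuousBounded ℝ (stateMap Ω hT v))
        =ᵐ[volume.restrict (Ioo (0 : ℝ) T)] fun t => toH Ω (v.1 t) := by
    intro v
    have h := BoundedContinuousFunction.coeFn_toLp (p := 2) (volume.restrict (Ioo (0 : ℝ) T)) ℝ
      ((toH Ω).compLeftContinuousBounded ℝ (stateMap Ω hT v))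
    filter_upwards [h, ae_restrict_mem measurableSet_Ioo] with t ht htI
    exact ht.trans (congrArg (toH Ω)
      (extendIcc_apply_of_mem hT v.2.2.1.continuousOn (Ioo_subset_Icc_self htI)))
  constructor
  · rintro ⟨v, hv, h1, h2⟩
    exact ⟨⟨v, hv⟩, Prod.ext (Lp.ext (h1.trans (hs ⟨v, hv⟩).symm))
      (Lp.ext (h2.trans (coeFn_classicalBMap hT ⟨v, hv⟩).symm))⟩
  · rintro ⟨v, rfl⟩
    exact ⟨v.1, v.2, hs v, coeFn_classicalBMap hT v⟩

end LinearMaps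

/-! ### Weak form of the equation and density of the range -/

/-- Two integrations by parts in time, combined in the primitive `F`, together with the symmetry of
the Dirichlet form and `A J k = k - J k`. The cutoff `η` removes all boundary terms. -/
theorem integral_inner_classicalB (hT : 0 < T) {v : ℝ → domainA Ω} (hv : v ∈ classC2T Ω T)
    {η : ℝ → ℝ} (hη : ContDiff ℝ ∞ η) (hηs : tsupport η ⊆ Ioo 0 T) (k : H Ω) :
    ∫ t in Ioo 0 T, ⟪classicalB Ω T v t, η t • resolvent Ω k⟫_ℝ =
      ∫ t in Ioo 0 T, ⟪toH Ω (v t),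
        deriv (deriv η) t • resolvent Ω k + η t • (k - resolvent Ω k)⟫_ℝ := by
  have hη0 : ∀ t ∉ Ioo 0 T, η t = 0 := fun t ht =>
    image_eq_zero_of_notMem_tsupport fun h => ht (hηs h)
  have hη0' : ∀ t ∉ Ioo 0 T, deriv η t = 0 := fun t ht =>
    image_eq_zero_of_notMem_tsupport fun h => ht (hηs (tsupport_deriv_subset (𝕜 := ℝ) h))
  have hη1 : ContDiff ℝ ∞ (deriv η) := (contDiff_infty_iff_deriv.1 hη).2
  have hη2 : ContDiff ℝ ∞ (deriv (deriv η)) := (contDiff_infty_iff_deriv.1 hη1).2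
  have hx : ContinuousOn (fun t => toH Ω (v t)) (Icc 0 T) := hv.1.continuousOn
  have i1 : IntegrableOn (fun t => ⟪classicalB Ω T v t, η t • resolvent Ω k⟫_ℝ) (Icc 0 T) :=
    ((continuousOn_classicalB hT hv).inner
      (hη.continuous.continuousOn.smul continuousOn_const)).integrableOn_Icc
  have i2 : IntegrableOn (fun t => ⟪toH Ω (v t),
      deriv (deriv η) t • resolvent Ω k + η t • (k - resolvent Ω k)⟫_ℝ) (Icc 0 T) :=
    (hx.inner ((hη2.continuous.continuousOn.smul continuousOn_const).add
      (hη.continuous.continuousOn.smul continuousOn_const))).integrableOn_Icc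
  rw [← sub_eq_zero, ← integral_sub (i1.mono_set Ioo_subset_Icc_self)
    (i2.mono_set Ioo_subset_Icc_self), ← integral_Ioc_eq_integral_Ioo,
    ← intervalIntegral.integral_of_le hT.le]
  let p := derivWithin (fun t => toH Ω (v t)) (Icc 0 T)
  let F : ℝ → ℝ := fun t => η t * ⟪p t, resolvent Ω k⟫_ℝ
    - deriv η t * ⟪toH Ω (v t), resolvent Ω k⟫_ℝ
  have hFc : ContinuousOn F (Icc 0 T) :=
    (hη.continuous.continuousOn.mul ((continuousOn_velocity hT hv).inner continuousOn_const)).sub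
      (hη1.continuous.continuousOn.mul (hx.inner continuousOn_const))
  rw [intervalIntegral.integral_eq_sub_of_hasDerivAt_of_le (f := F) hT.le hFc]
  · simp [F, hη0, hη0']
  · intro t ht
    have htI := Ioo_subset_Icc_self ht
    have hn : Icc 0 T ∈ nhds t := Icc_mem_nhds ht.1 ht.2
    have h1 := (((hasDerivWithinAt_velocity hT hv htI).hasDerivAt hn).inner ℝ
      (hasDerivAt_const t (resolvent Ω k)))
    have h2 := (((hasDerivWithinAt_toH hv htI).hasDerivAt hn).inner ℝ
      (hasDerivAt_const t (resolvent Ω k)))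
    have h3 := (hη.differentiable (by simp) t).hasDerivAt
    have h4 := (hη1.differentiable (by simp) t).hasDerivAt
    refine ((h3.mul h1).sub (h4.mul h2)).congr_deriv ?_
    have h5 : ⟪opA Ω (v t), resolvent Ω k⟫_ℝ = ⟪toH Ω (v t), k - resolvent Ω k⟫_ℝ := by
      have := inner_opA Ω (v t) ((toH Ω).adjoint k)
      rw [dirichletForm, real_inner_comm (grad Ω _)] at this
      rw [real_inner_comm _ (toH Ω (v t)), ← dirichletForm_adjoint_toH]
      exact this
    simp only [classicalB, inner_add_left, inner_add_right, real_inner_smul_right, h5,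
      inner_zero_right, zero_add]
    ring
  · exact (intervalIntegrable_iff_integrableOn_Icc_of_le hT.le).2 (i1.sub i2)

/-- The solution of a regularised problem, pushed into the domain of `A`. -/
theorem resolventDomain_mem_classC2T {z p χ : ℝ → H Ω} {L : H Ω →L[ℝ] H Ω}
    (hz : ∀ t, HasDerivAt z (p t) t) (hp : ∀ t, HasDerivAt p (χ t - L (z t)) t)
    (hχ : Continuous χ) (hzT : z T = 0) (hpT : p T = 0) :
    (fun t => resolventDomain Ω (resolvent Ω (z t))) ∈ classC2T Ω T := by
  have hzc : Continuous z := continuous_iff_continuousAt.2 fun t => (hz t).continuousAt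
  have hpc : Continuous p := continuous_iff_continuousAt.2 fun t => (hp t).continuousAt
  have hz2 : ContDiff ℝ 2 z := contDiff_two_of_hasDerivAt hz hp (by fun_prop)
  have hz1 : ContDiff ℝ 1 z := contDiff_one_of_hasDerivAt hz hpc
  refine ⟨?_, ?_, ?_, ?_, ?_⟩
  · exact ((resolvent Ω).contDiff.comp ((resolvent Ω).contDiff.comp hz2)).contDiffOn
  · exact ((toH Ω).adjoint.contDiff.comp ((resolvent Ω).contDiff.comp hz1)).contDiffOn
  · simp only [opA_resolventDomain]
    fun_prop
  · ext1
    simp [resolventDomain, hzT]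
  · have h := (((toH Ω).adjoint.comp (resolvent Ω)).hasFDerivAt.comp_hasDerivAt T
      (hz T)).hasDerivWithinAt (s := Icc 0 T)
    rw [hpT, map_zero] at h
    exact h

/-- Inserting `J Aₙ = 1 - J - (1 - J)ⁿ⁺¹` and `A J = 1 - J` cancels all else. One factor `J` puts `v
= J² z` into `D(A)`; the other remains in front of `(1 - J)ⁿ⁺¹`, where it yields decay in `n`. -/
theorem classicalB_resolventDomain (hT : 0 < T) {z p χ : ℝ → H Ω} {n : ℕ}
    (hz : ∀ t, HasDerivAt z (p t) t)
    (hp : ∀ t, HasDerivAt p (χ t - approx (resolvent Ω) n (z t)) t) {t : ℝ} (ht : t ∈ Icc 0 T) :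
    classicalB Ω T (fun t => resolventDomain Ω (resolvent Ω (z t))) t =
      resolvent Ω (resolvent Ω (χ t))
        + resolvent Ω (((1 - resolvent Ω) ^ (n + 1)) (z t)) := by
  have h1 : iteratedDerivWithin 2 (fun t => toH Ω (resolventDomain Ω (resolvent Ω (z t))))
      (Icc 0 T) t = resolvent Ω (resolvent Ω (χ t - approx (resolvent Ω) n (z t))) := by
    let K := (resolvent Ω).comp (resolvent Ω)
    exact iteratedDerivWithin_two_eq (f := fun t => K (z t)) (f' := fun t => K (p t)) hT
      (fun s => K.hasFDerivAt.comp_hasDerivAt s (hz s))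
      (fun s => K.hasFDerivAt.comp_hasDerivAt s (hp s)) ht
  rw [classicalB, h1, opA_resolventDomain, map_sub, map_sub, apply_approx]
  simp only [map_sub]
  abel

/-- The range of `B∘*` is dense in `L₂(I; H)`. -/
theorem denseRange_classicalBMap (hT : 0 < T) : DenseRange (classicalBMap Ω hT) := by
  have hbot : (LinearMap.range (classicalBMap Ω hT))ᗮ = ⊥ := by
    rw [Submodule.eq_bot_iff]
    intro u hu
    let J := resolvent Ω
    refine eq_zero_of_forall_test u (J.comp J) (fun x hx => ?_) fun η hη hηc hηs h => ?_
    · have h0 : resolvent Ω x = 0 := eq_zero_of_inner_resolvent _ fun k =>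
        (isPositive_resolvent.inner_left_eq_inner_right x (J k)).trans (hx k)
      refine eq_zero_of_inner_resolvent x fun k => ?_
      rw [← isPositive_resolvent.inner_left_eq_inner_right, h0, inner_zero_left]
    · let χ : ℝ → H Ω := fun t => η t • h
      have hχ : Continuous χ := hη.continuous.smul continuous_const
      let D := √(4 * T * ∫ s in Ioo 0 T, ‖χ s‖ ^ 2) * T
      have hD : 0 ≤ D := by positivity
      have hm : MemLp (fun t => η t • J (J h)) 2 (volume.restrict (Ioo 0 T)) :=
        (hη.continuous.smul continuous_const).memLp_of_hasCompactSupport hηc.smul_right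
      have hi : Integrable (fun t => ⟪u t, η t • J (J h)⟫_ℝ) (volume.restrict (Ioo 0 T)) := by
        refine (L2.integrable_inner (𝕜 := ℝ) u hm.toLp).congr ?_
        filter_upwards [hm.coeFn_toLp] with t ht
        rw [ht]
      have hui : Integrable (fun t => ‖u t‖) (volume.restrict (Ioo 0 T)) :=
        ((Lp.memLp u).integrable (by norm_num)).norm
      -- As `u` is orthogonal to the range, subtracting `B∘* v` for the `n`-th regularised solution
      -- `v` changes nothing and leaves only the error term.
      have hbound : ∀ n : ℕ, ‖∫ t in Ioo 0 T, ⟪u t, η t • J (J h)⟫_ℝ‖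
          ≤ (∫ t in Ioo 0 T, ‖u t‖) * (D / √(n + 1)) := by
        intro n
        obtain ⟨z, p, hz, hp, hzT, hpT, hzb⟩ :=
          exists_approx_solution isPositive_resolvent sq_norm_resolvent_le hχ hT n
        let v : classC2T Ω T := ⟨_, resolventDomain_mem_classC2T hz hp hχ hzT hpT⟩
        have h0 : ∫ t in Ioo 0 T, ⟪u t, classicalBMap Ω hT v t⟫_ℝ = 0 := by
          rw [← L2.inner_def, real_inner_comm]
          exact hu _ (LinearMap.mem_range_self _ v)
        have h1 : ∫ t in Ioo 0 T, ⟪u t, η t • J (J h)⟫_ℝ = ∫ t in Ioo 0 T,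
            (⟪u t, η t • J (J h)⟫_ℝ - ⟪u t, classicalBMap Ω hT v t⟫_ℝ) := by
          rw [integral_sub hi (L2.integrable_inner u _), h0, sub_zero]
        rw [h1, ← integral_mul_const]
        refine norm_integral_le_of_norm_le (hui.mul_const _) ?_
        filter_upwards [coeFn_classicalBMap hT v, ae_restrict_mem measurableSet_Ioo] with t ht htI
        have htc := Ioo_subset_Icc_self htI
        rw [← inner_sub_right, ht]
        refine (norm_inner_le_norm _ _).trans ?_
        gcongr
        have hB := classicalB_resolventDomain hT hz hp htc
        have hχJ : resolvent Ω (resolvent Ω (χ t)) = η t • J (J h) := by simp [χ, J]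
        rw [hB, hχJ, norm_sub_rev, add_sub_cancel_left, le_div_iff₀ (by positivity)]
        refine le_of_sq_le_sq ?_ hD
        -- The power `n + 1` gives the factor `n + 2`, which is weakened to `n + 1`.
        have h1 := succ_mul_sq_norm_le (J := resolvent Ω) sq_norm_resolvent_le (n + 1) (z t)
        have h2 := pow_le_pow_left₀ (norm_nonneg _) (hzb t htc) 2
        rw [mul_pow, Real.sq_sqrt (by positivity)]
        rw [Nat.cast_succ] at h1
        change ‖z t‖ ^ 2 ≤ D ^ 2 at h2
        nlinarith [sq_nonneg ‖resolvent Ω (((1 - resolvent Ω) ^ (n + 1)) (z t))‖]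
      have hlim : Filter.Tendsto (fun n : ℕ => (∫ t in Ioo 0 T, ‖u t‖) * (D / √(n + 1)))
          Filter.atTop (nhds 0) := by
        have h1 : Filter.Tendsto (fun n : ℕ => √((n : ℝ) + 1)) Filter.atTop Filter.atTop :=
          Real.tendsto_sqrt_atTop.comp
            (Filter.tendsto_atTop_add_const_right _ _ tendsto_natCast_atTop_atTop)
        simpa using (tendsto_const_nhds.div_atTop h1).const_mul (∫ t in Ioo 0 T, ‖u t‖)
      exact norm_le_zero_iff.1 (ge_of_tendsto' hlim hbound)
  have := (Submodule.topologicalClosure_eq_top_iff (K := LinearMap.range (classicalBMap Ω hT))).2 hbot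
  rw [DenseRange, ← LinearMap.coe_range, ← Submodule.dense_iff_topologicalClosure_eq_top] at *
  exact this

/-- `w ↦ ∫₀ᵀ ⟨f(t), w(t)⟩ dt` on `C([0,T]; Y)`. -/
def pairing {Y : Type} [NormedAddCommGroup Y] [NormedSpace ℝ Y]
    (f : BochnerL2 T (StrongDual ℝ Y)) :
    BoundedContinuousFunction ℝ Y →L[ℝ] ℝ :=
  have hf : Integrable f (volume.restrict (Ioo (0 : ℝ) T)) :=
    (Lp.memLp f).integrable (by norm_num)
  have hb : ∀ (w : BoundedContinuousFunction ℝ Y) (t : ℝ), ‖f t (w t)‖ ≤ ‖f t‖ * ‖w‖ :=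
    fun w t => (f t).le_opNorm_of_le (w.norm_coe_le_norm t)
  have hi : ∀ w : BoundedContinuousFunction ℝ Y,
      Integrable (fun t => f t (w t)) (volume.restrict (Ioo (0 : ℝ) T)) := fun w =>
    (hf.norm.mul_const ‖w‖).mono'
      (isBoundedBilinearMap_apply.continuous.comp_aestronglyMeasurable
        (hf.1.prodMk w.continuous.aestronglyMeasurable))
      (Filter.Eventually.of_forall fun t => hb w t)
  LinearMap.mkContinuous
    { toFun := fun w => ∫ t in Ioo 0 T, f t (w t)
      map_add' := fun w w' => by
        rw [← integral_add (hi w) (hi w')]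
        exact integral_congr_ae (Filter.Eventually.of_forall fun t => map_add (f t) _ _)
      map_smul' := fun c w => by
        rw [RingHom.id_apply, ← integral_smul]
        exact integral_congr_ae (Filter.Eventually.of_forall fun t => map_smul (f t) _ _) }
    (∫ t in Ioo 0 T, ‖f t‖) fun w => by
      change ‖∫ t in Ioo 0 T, f t (w t)‖ ≤ _
      rw [← integral_mul_const]
      exact norm_integral_le_of_norm_le (hf.norm.mul_const _)
        (Filter.Eventually.of_forall fun t => hb w t)

theorem exists_extension_of_denseRange {W Y G : Type*} [AddCommGroup W] [Module ℝ W]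
    [NormedAddCommGroup Y] [NormedSpace ℝ Y] [CompleteSpace Y] [NormedAddCommGroup G]
    [NormedSpace ℝ G] {S : Submodule ℝ W} (f : S →ₗ[ℝ] BoundedContinuousFunction ℝ Y)
    (e : S →ₗ[ℝ] G) (he : DenseRange e) {C : ℝ} (hC : ∀ x, ‖f x‖ ≤ C * ‖e x‖) :
    ∃ g : G →L[ℝ] BoundedContinuousFunction ℝ Y, ∀ x, g (e x) = f x :=
  ⟨f.extendOfNorm e, LinearMap.extendOfNorm_eq he ⟨C, hC⟩⟩

/-! ### The solution operator and the closed graph -/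

section Solution

variable (Ω)

theorem exists_extension_state (hT : 0 < T) :
    ∃ g : TrialSpace Ω T →L[ℝ] BoundedContinuousFunction ℝ (V Ω),
      ∀ v, g (classicalBMap Ω hT v) = stateMap Ω hT v :=
  exists_extension_of_denseRange _ _ (denseRange_classicalBMap hT) (norm_stateMap_le hT)

theorem exists_extension_velocity (hT : 0 < T) :
    ∃ g : TrialSpace Ω T →L[ℝ] BoundedContinuousFunction ℝ (H Ω),
      ∀ v, g (classicalBMap Ω hT v) = velocityMap Ω hT v :=
  exists_extension_of_denseRange _ _ (denseRange_classicalBMap hT) (norm_velocityMap_le hT)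

/-- The continuous extension to `L₂(I; H)` of `B∘* v ↦ v`. -/
def state (hT : 0 < T) : TrialSpace Ω T →L[ℝ] BoundedContinuousFunction ℝ (V Ω) :=
  (exists_extension_state Ω hT).choose

/-- The continuous extension to `L₂(I; H)` of `B∘* v ↦ v'`. -/
def velocity (hT : 0 < T) : TrialSpace Ω T →L[ℝ] BoundedContinuousFunction ℝ (H Ω) :=
  (exists_extension_velocity Ω hT).choose

/-- The solution operator of the adjoint problem, as an operator on `L₂(I; H)`. -/
def solution (hT : 0 < T) : TrialSpace Ω T →L[ℝ] TrialSpace Ω T :=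
  (toBochner T (H Ω)).comp (((toH Ω).compLeftContinuousBounded ℝ).comp (state Ω hT))

variable {Ω}

theorem state_classicalBMap (hT : 0 < T) (v : classC2T Ω T) :
    state Ω hT (classicalBMap Ω hT v) = stateMap Ω hT v :=
  (exists_extension_state Ω hT).choose_spec v

theorem velocity_classicalBMap (hT : 0 < T) (v : classC2T Ω T) :
    velocity Ω hT (classicalBMap Ω hT v) = velocityMap Ω hT v :=
  (exists_extension_velocity Ω hT).choose_spec v

theorem coeFn_solution (hT : 0 < T) (φ : TrialSpace Ω T) :
    solution Ω hT φ =ᵐ[volume.restrict (Ioo (0 : ℝ) T)] fun t => toH Ω (state Ω hT φ t) :=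
  BoundedContinuousFunction.coeFn_toLp (p := 2) (volume.restrict (Ioo (0 : ℝ) T)) ℝ
    ((toH Ω).compLeftContinuousBounded ℝ (state Ω hT φ))

/-- One inclusion holds because the graph of the continuous `solution` is closed, the other because
the forces of `𝒞²_T` are dense. -/
theorem mem_closedGraph_iff (hT : 0 < T) (q : TrialSpace Ω T × TrialSpace Ω T) :
    q ∈ closedGraph Ω T ↔ q.1 = solution Ω hT q.2 := by
  have hcl : ∀ v : classC2T Ω T,
      (solution Ω hT (classicalBMap Ω hT v), classicalBMap Ω hT v) ∈ classicalGraph Ω T := by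
    intro v
    rw [mem_classicalGraph_iff hT]
    refine ⟨v, ?_⟩
    rw [← state_classicalBMap hT]
    rfl
  constructor
  · intro hq
    have hc : IsClosed {q : TrialSpace Ω T × TrialSpace Ω T | q.1 = solution Ω hT q.2} :=
      isClosed_eq continuous_fst ((solution Ω hT).continuous.comp continuous_snd)
    refine closure_minimal (fun r hr => ?_) hc hq
    obtain ⟨v, rfl⟩ := (mem_classicalGraph_iff hT r).1 hr
    change _ = _
    rw [← state_classicalBMap hT]
    rfl
  · intro hq
    have h : ∀ φ : TrialSpace Ω T, (solution Ω hT φ, φ) ∈ closedGraph Ω T := by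
      intro φ
      refine (denseRange_classicalBMap hT).induction_on
        (p := fun φ => (solution Ω hT φ, φ) ∈ closedGraph Ω T) φ ?_ fun v => subset_closure (hcl v)
      exact isClosed_closure.preimage ((solution Ω hT).continuous.prodMk continuous_id)
    rw [← Prod.mk.eta (p := q), hq]
    exact h q.2

theorem memLp_smul_const {η : ℝ → ℝ} (hη : Continuous η) (hηc : HasCompactSupport η)
    (k : H Ω) : MemLp (fun t => η t • k) 2 (volume.restrict (Ioo 0 T)) :=
  (hη.smul continuous_const).memLp_of_hasCompactSupport hηc.smul_right

theorem inner_toLp {α X : Type*} [MeasurableSpace α] {μ : Measure α} [NormedAddCommGroup X]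
    [InnerProductSpace ℝ X] (ψ : Lp X 2 μ) {g : α → X} (hg : MemLp g 2 μ) :
    ⟪ψ, hg.toLp⟫_ℝ = ∫ t, ⟪ψ t, g t⟫_ℝ ∂μ := by
  rw [L2.inner_def]
  refine integral_congr_ae ?_
  filter_upwards [hg.coeFn_toLp] with t ht
  rw [ht]

/-- Both sides are continuous in `φ`, so it suffices to integrate by parts on the dense range of
`B∘*`. -/
theorem inner_eq_inner_solution (hT : 0 < T) {η : ℝ → ℝ} (hη : ContDiff ℝ ∞ η)
    (hηs : tsupport η ⊆ Ioo 0 T) (k : H Ω)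
    (ha : MemLp (fun t => η t • resolvent Ω k) 2 (volume.restrict (Ioo 0 T)))
    (hb : MemLp (fun t => deriv (deriv η) t • resolvent Ω k + η t • (k - resolvent Ω k)) 2
      (volume.restrict (Ioo 0 T))) (φ : TrialSpace Ω T) :
    ⟪φ, ha.toLp⟫_ℝ = ⟪solution Ω hT φ, hb.toLp⟫_ℝ := by
  refine (denseRange_classicalBMap hT).induction_on
    (p := fun φ => ⟪φ, ha.toLp⟫_ℝ = ⟪solution Ω hT φ, hb.toLp⟫_ℝ) φ ?_ fun v => ?_
  · exact isClosed_eq (continuous_id.inner continuous_const)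
      ((solution Ω hT).continuous.inner continuous_const)
  · have e1 : ∫ t in Ioo 0 T, ⟪classicalBMap Ω hT v t, η t • resolvent Ω k⟫_ℝ
        = ∫ t in Ioo 0 T, ⟪classicalB Ω T v.1 t, η t • resolvent Ω k⟫_ℝ := by
      refine integral_congr_ae ?_
      filter_upwards [coeFn_classicalBMap hT v] with t ht
      rw [ht]
    rw [inner_toLp, inner_toLp, e1, integral_inner_classicalB hT v.2 hη hηs]
    refine integral_congr_ae ?_
    filter_upwards [coeFn_solution hT (classicalBMap Ω hT v),
      ae_restrict_mem measurableSet_Ioo] with t ht2 htI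
    have : stateMap Ω hT v t = (v.1 t : V Ω) :=
      extendIcc_apply_of_mem hT v.2.2.1.continuousOn (Ioo_subset_Icc_self htI)
    rw [ht2, state_classicalBMap, this]

/-- In the weak form all derivatives fall on the test function, so a vanishing solution makes `φ`
orthogonal to every `η(t) J k`; the range of `J` separates points. -/
theorem eq_zero_of_solution_eq_zero (hT : 0 < T) {φ : TrialSpace Ω T}
    (h0 : solution Ω hT φ = 0) : φ = 0 := by
  refine eq_zero_of_forall_test φ (resolvent Ω) eq_zero_of_inner_resolvent
    fun η hη hηc hηs k => ?_
  have hη2 : ContDiff ℝ ∞ (deriv (deriv η)) :=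
    (contDiff_infty_iff_deriv.1 (contDiff_infty_iff_deriv.1 hη).2).2
  have ha : MemLp (fun t => η t • resolvent Ω k) 2 (volume.restrict (Ioo 0 T)) :=
    memLp_smul_const hη.continuous hηc _
  have hb : MemLp (fun t => deriv (deriv η) t • resolvent Ω k + η t • (k - resolvent Ω k)) 2
      (volume.restrict (Ioo 0 T)) :=
    (memLp_smul_const hη2.continuous hηc.deriv.deriv _).add
      (memLp_smul_const hη.continuous hηc _)
  rw [← inner_toLp φ ha, inner_eq_inner_solution hT hη hηs k ha hb, h0, inner_zero_left]

/-- A limit pair `(0, φ)` has `S φ = 0`, so closability is the injectivity of the solution operator.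
-/
theorem graph_opB (hT : 0 < T) : (opB Ω T).graph = closedGraph Ω T := by
  refine Submodule.toLinearPMap_graph_eq _ fun q hq h0 => ?_
  exact eq_zero_of_solution_eq_zero hT (((mem_closedGraph_iff hT q).1 hq).symm.trans h0)

theorem incl_eq_solution (hT : 0 < T) (v : TestSpace Ω T) : v.incl = solution Ω hT v.B := by
  have h : (v.incl, v.B) ∈ (opB Ω T).graph := LinearPMap.mem_graph (opB Ω T) v
  rw [graph_opB hT] at h
  exact (mem_closedGraph_iff hT _).1 h

theorem B_surjective (hT : 0 < T) :
    Function.Surjective (TestSpace.B : TestSpace Ω T →ₗ[ℝ] TrialSpace Ω T) := by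
  intro φ
  have h : (solution Ω hT φ, φ) ∈ (opB Ω T).graph := by
    rw [graph_opB hT]
    exact (mem_closedGraph_iff hT _).2 rfl
  obtain ⟨y, -, hy⟩ := (LinearPMap.mem_graph_iff (opB Ω T)).1 h
  exact ⟨y, hy⟩

theorem eq_zero_of_B_eq_zero (hT : 0 < T) {v : TestSpace Ω T} (hv : v.B = 0) : v = 0 := by
  have h := incl_eq_solution hT v
  rw [hv, map_zero] at h
  exact Subtype.ext h

/-! ### Continuous representatives and the right-hand side -/

/-- The fundamental theorem of calculus on `𝒞²_T`, extended by density; it identifies the extended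
velocity as the derivative of the extended state. -/
theorem toH_state (hT : 0 < T) (φ : TrialSpace Ω T) {t : ℝ} (ht : t ∈ Icc 0 T) :
    toH Ω (state Ω hT φ t) = ∫ s in T..t, velocity Ω hT φ s := by
  refine (denseRange_classicalBMap hT).induction_on
    (p := fun φ => toH Ω (state Ω hT φ t) = ∫ s in T..t, velocity Ω hT φ s) φ ?_ fun v => ?_
  · refine isClosed_eq ?_ ?_
    · exact (toH Ω).continuous.comp
        ((BoundedContinuousFunction.evalCLM ℝ t).continuous.comp (state Ω hT).continuous)
    · refine intervalIntegral.continuous_parametric_intervalIntegral_of_continuous' ?_ T t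
      exact continuous_eval.comp
        (((velocity Ω hT).continuous.comp continuous_fst).prodMk continuous_snd)
  · have hsub : Icc t T ⊆ Icc 0 T := Icc_subset_Icc_left ht.1
    have h1 := intervalIntegral.integral_eq_sub_of_hasDerivAt_of_le (a := t) (b := T) ht.2
      (v.2.1.continuousOn.mono hsub)
      (fun s hs => (hasDerivWithinAt_toH v.2 (hsub (Ioo_subset_Icc_self hs))).hasDerivAt
        (Icc_mem_nhds (ht.1.trans_lt hs.1) hs.2))
      (((continuousOn_velocity hT v.2).mono hsub).intervalIntegrable_of_Icc ht.2)
    rw [state_classicalBMap, velocity_classicalBMap, intervalIntegral.integral_symm]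
    have h2 : ∫ s in t..T, velocityMap Ω hT v s
        = ∫ s in t..T, derivWithin (fun t => toH Ω (v.1 t)) (Icc 0 T) s := by
      refine intervalIntegral.integral_congr fun s hs => ?_
      rw [uIcc_of_le ht.2] at hs
      exact extendIcc_apply_of_mem hT (continuousOn_velocity hT v.2) (hsub hs)
    have h3 : stateMap Ω hT v t = (v.1 t : V Ω) :=
      extendIcc_apply_of_mem hT v.2.2.1.continuousOn ht
    rw [h2, h1, h3, v.2.2.2.2.1]
    simp

theorem hasDerivWithinAt_toH_state (hT : 0 < T) (φ : TrialSpace Ω T) {t : ℝ}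
    (ht : t ∈ Icc 0 T) :
    HasDerivWithinAt (fun t => toH Ω (state Ω hT φ t)) (velocity Ω hT φ t) (Icc 0 T) t := by
  have hc : Continuous (velocity Ω hT φ) := (velocity Ω hT φ).continuous
  exact (intervalIntegral.integral_hasDerivAt_right (hc.intervalIntegrable T t)
    (hc.stronglyMeasurableAtFilter _ _) hc.continuousAt).hasDerivWithinAt.congr
    (fun s hs => toH_state hT φ hs) (toH_state hT φ ht)

theorem isRepresentative_state (hT : 0 < T) (v : TestSpace Ω T) :
    IsRepresentative (state Ω hT v.B) v.incl where
  ae_eq := by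
    rw [incl_eq_solution hT]
    exact coeFn_solution hT v.B
  continuousOn := (state Ω hT v.B).continuous.continuousOn
  contDiffOn := by
    have hc : Continuous (velocity Ω hT v.B) := (velocity Ω hT v.B).continuous
    have h : ContDiff ℝ 1 fun t => ∫ s in T..t, velocity Ω hT v.B s :=
      contDiff_one_of_hasDerivAt (fun t =>
        intervalIntegral.integral_hasDerivAt_right (hc.intervalIntegrable T t)
          (hc.stronglyMeasurableAtFilter _ _) hc.continuousAt) hc
    exact h.contDiffOn.congr fun t ht => toH_state hT v.B ht

/-- Continuity turns equality almost everywhere in `H` into equality on `[0, T]`, and the embedding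
of `V` is injective. -/
theorem IsRepresentative.eqOn (hT : 0 < T) {v : TrialSpace Ω T} {w w' : ℝ → V Ω}
    (hw : IsRepresentative w v) (hw' : IsRepresentative w' v) : EqOn w' w (Icc 0 T) := by
  have hae : (fun t => toH Ω (w' t)) =ᵐ[volume.restrict (Icc (0 : ℝ) T)]
      fun t => toH Ω (w t) := by
    rw [← Measure.restrict_congr_set Ioo_ae_eq_Icc]
    exact hw'.ae_eq.symm.trans hw.ae_eq
  have h := Measure.eqOn_Icc_of_ae_eq volume hT.ne hae hw'.contDiffOn.continuousOn
    hw.contDiffOn.continuousOn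
  exact fun t ht => toH_injective (h ht)

theorem rhs_congr (hT : 0 < T) (f : BochnerL2 T (StrongDual ℝ (V Ω))) (u₀ : H Ω)
    (u₁ : StrongDual ℝ (V Ω)) {w w' : ℝ → V Ω} (h : EqOn w' w (Icc 0 T)) :
    rhs T f u₀ u₁ w' = rhs T f u₀ u₁ w := by
  have h0 : (0 : ℝ) ∈ Icc 0 T := left_mem_Icc.2 hT.le
  have h1 : ∫ t in Ioo 0 T, f t (w' t) = ∫ t in Ioo 0 T, f t (w t) := by
    refine integral_congr_ae ?_
    filter_upwards [ae_restrict_mem measurableSet_Ioo] with t ht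
    rw [h (Ioo_subset_Icc_self ht)]
  have h2 : derivWithin (fun t => toH Ω (w' t)) (Icc 0 T) 0
      = derivWithin (fun t => toH Ω (w t)) (Icc 0 T) 0 :=
    derivWithin_congr (fun t ht => congrArg (toH Ω) (h ht)) (congrArg (toH Ω) (h h0))
  rw [rhs, rhs, h1, h h0, h2]

/-- The right-hand side as a functional of `φ = B* v`. -/
def rhsFunctional (hT : 0 < T) (f : BochnerL2 T (StrongDual ℝ (V Ω))) (u₀ : H Ω)
    (u₁ : StrongDual ℝ (V Ω)) : StrongDual ℝ (TrialSpace Ω T) :=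
  (pairing f).comp (state Ω hT)
    + u₁.comp ((BoundedContinuousFunction.evalCLM ℝ (0 : ℝ)).comp (state Ω hT))
    - (innerSL ℝ u₀).comp ((BoundedContinuousFunction.evalCLM ℝ (0 : ℝ)).comp (velocity Ω hT))

theorem rhsFunctional_apply (hT : 0 < T) (f : BochnerL2 T (StrongDual ℝ (V Ω))) (u₀ : H Ω)
    (u₁ : StrongDual ℝ (V Ω)) (φ : TrialSpace Ω T) :
    rhsFunctional hT f u₀ u₁ φ = rhs T f u₀ u₁ (state Ω hT φ) := by
  have h0 : (0 : ℝ) ∈ Icc 0 T := left_mem_Icc.2 hT.le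
  rw [rhs, (hasDerivWithinAt_toH_state hT φ h0).derivWithin (uniqueDiffOn_Icc hT 0 h0)]
  rfl

/-! ### Riesz representation, completeness and the two constants -/

/-- The solution is the Riesz representative of `g` as a functional of `φ = B* v`. Uniqueness holds
since `B* v` runs through all of `L₂(I; H)`. -/
theorem existsUnique_veryWeakSolution (hT : 0 < T) (f : BochnerL2 T (StrongDual ℝ (V Ω)))
    (u₀ : H Ω) (u₁ : StrongDual ℝ (V Ω)) :
    ∃! u : TrialSpace Ω T, ∀ (v : TestSpace Ω T) (w : ℝ → V Ω),
      IsRepresentative w v.incl → formB u v = rhs T f u₀ u₁ w := by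
  refine ⟨(InnerProductSpace.toDual ℝ _).symm (rhsFunctional hT f u₀ u₁), fun v w hw => ?_,
    fun u hu => ?_⟩
  · rw [formB, InnerProductSpace.toDual_symm_apply, rhsFunctional_apply]
    exact rhs_congr hT f u₀ u₁ (hw.eqOn hT (isRepresentative_state hT v))
  · refine ext_inner_right ℝ fun φ => ?_
    obtain ⟨v, rfl⟩ := B_surjective hT φ
    rw [InnerProductSpace.toDual_symm_apply, rhsFunctional_apply]
    exact hu v _ (isRepresentative_state hT v)

theorem completeSpace_testSpace (hT : 0 < T) : CompleteSpace (TestSpace Ω T) := by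
  have h : Isometry (TestSpace.B : TestSpace Ω T →ₗ[ℝ] TrialSpace Ω T) :=
    AddMonoidHomClass.isometry_of_norm _ fun _ => rfl
  exact (h.isUniformInducing.completeSpace_congr (B_surjective hT)).2 inferInstance

/-- Cauchy-Schwarz, with the supremum attained at the `v` for which `B* v = u`. -/
theorem iSup_formB_div (hT : 0 < T) {u : TrialSpace Ω T} (hu : u ≠ 0) :
    ⨆ v : {v : TestSpace Ω T // v ≠ 0},
      ((formB u v.1 / (‖u‖ * ‖v.1‖) : ℝ) : EReal) = 1 := by
  refine le_antisymm (iSup_le fun v => ?_) ?_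
  · rw [← EReal.coe_one, EReal.coe_le_coe_iff]
    exact div_le_one_of_le₀ (real_inner_le_norm _ _) (by positivity)
  · obtain ⟨v, hv⟩ := B_surjective hT u
    have hv0 : v ≠ 0 := fun h => hu (by rw [← hv, h, map_zero])
    refine le_trans (le_of_eq ?_) (le_iSup (fun v : {v : TestSpace Ω T // v ≠ 0} =>
      ((formB u v.1 / (‖u‖ * ‖v.1‖) : ℝ) : EReal)) ⟨v, hv0⟩)
    have h : formB u v / (‖u‖ * ‖v‖) = 1 := by
      have hn : ‖u‖ ≠ 0 := norm_ne_zero_iff.2 hu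
      rw [formB, TestSpace.norm_def, hv, real_inner_self_eq_norm_mul_norm]
      exact div_self (mul_ne_zero hn hn)
    rw [h, EReal.coe_one]

theorem nontrivial_Lp {α X : Type*} [MeasurableSpace α] (μ : Measure α) [IsFiniteMeasure μ]
    [NeZero μ] [NormedAddCommGroup X] [Nontrivial X] : Nontrivial (Lp X 2 μ) := by
  obtain ⟨c, hc⟩ := exists_ne (0 : X)
  refine ⟨Lp.const 2 μ c, 0, fun h => hc ?_⟩
  have h1 := Lp.coeFn_const (p := 2) (μ := μ) (c := c)
  rw [h] at h1
  obtain ⟨t, ht1, ht2⟩ := (h1.and (Lp.coeFn_zero X 2 μ)).exists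
  rw [← show (0 : Lp X 2 μ) t = c from ht1, ht2, Pi.zero_apply]

/-- Needed because the outer infimum and supremum in `EReal` would be `⊤` and `⊥` over an empty set
of trial functions. -/
theorem nontrivial_trialSpace (hT : 0 < T) (hne : (Ω : Set (Space d)).Nonempty)
    (hbdd : Bornology.IsBounded (Ω : Set (Space d))) : Nontrivial (TrialSpace Ω T) := by
  have : Fact (volume (Ω : Set (Space d)) < ⊤) := ⟨hbdd.measure_lt_top⟩
  have : NeZero (volume.restrict (Ω : Set (Space d))) :=
    ⟨fun h => (Ω.isOpen.measure_pos volume hne).ne' (Measure.restrict_eq_zero.1 h)⟩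
  have : NeZero (volume.restrict (Ioo (0 : ℝ) T)) :=
    ⟨fun h => by simpa [hT.not_ge] using Measure.restrict_eq_zero.1 h⟩
  have : Nontrivial (H Ω) := nontrivial_Lp _
  exact nontrivial_Lp _

end Solution

end WaveEq

end

theorem mainTheorem1 {d : ℕ} (hd : 1 ≤ d) (Ω : TopologicalSpace.Opens (EuclideanSpace ℝ (Fin d)))
    (hne : (Ω : Set (EuclideanSpace ℝ (Fin d))).Nonempty)
    (hconv : Convex ℝ (Ω : Set (EuclideanSpace ℝ (Fin d))))
    (hbdd : Bornology.IsBounded (Ω : Set (EuclideanSpace ℝ (Fin d))))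
    (T : ℝ) (hT : 0 < T)
    (f : WaveEq.BochnerL2 T (StrongDual ℝ (WaveEq.V Ω))) (u₀ : WaveEq.H Ω)
    (u₁ : StrongDual ℝ (WaveEq.V Ω)) :
    -- `B*` is well defined on the test space, and `‖v‖_𝕍 = ‖B* v‖` makes it a Hilbert space
    ((WaveEq.opB Ω T).graph = WaveEq.closedGraph Ω T ∧
      (∀ v : WaveEq.TestSpace Ω T, ‖v‖ = 0 → v = 0) ∧
      CompleteSpace (WaveEq.TestSpace Ω T)) ∧
    -- each test function has exactly one representative in `C([0,T]; V) ∩ C¹([0,T]; H)`,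
    -- so that `g(v)` is defined
    (∀ v : WaveEq.TestSpace Ω T, ∃ w : ℝ → WaveEq.V Ω, WaveEq.IsRepresentative w v.incl ∧
      ∀ w' : ℝ → WaveEq.V Ω, WaveEq.IsRepresentative w' v.incl →
        Set.EqOn w' w (Set.Icc 0 T)) ∧
    -- the variational problem has a unique solution
    (∃! u : WaveEq.TrialSpace Ω T, ∀ (v : WaveEq.TestSpace Ω T) (w : ℝ → WaveEq.V Ω),
      WaveEq.IsRepresentative w v.incl → WaveEq.formB u v = WaveEq.rhs T f u₀ u₁ w) ∧
    -- the inf-sup constant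
    (⨅ u : {u : WaveEq.TrialSpace Ω T // u ≠ 0}, ⨆ v : {v : WaveEq.TestSpace Ω T // v ≠ 0},
      ((WaveEq.formB u.1 v.1 / (‖u.1‖ * ‖v.1‖) : ℝ) : EReal)) = 1 ∧
    -- the continuity constant
    (⨆ u : {u : WaveEq.TrialSpace Ω T // u ≠ 0}, ⨆ v : {v : WaveEq.TestSpace Ω T // v ≠ 0},
      ((WaveEq.formB u.1 v.1 / (‖u.1‖ * ‖v.1‖) : ℝ) : EReal)) = 1 := by
  have : Nontrivial (WaveEq.TrialSpace Ω T) := WaveEq.nontrivial_trialSpace hT hne hbdd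
  have : Nonempty {u : WaveEq.TrialSpace Ω T // u ≠ 0} :=
    let ⟨u, hu⟩ := exists_ne (0 : WaveEq.TrialSpace Ω T)
    ⟨⟨u, hu⟩⟩
  refine ⟨⟨WaveEq.graph_opB hT, fun v hv => ?_, WaveEq.completeSpace_testSpace hT⟩, fun v => ?_,
    WaveEq.existsUnique_veryWeakSolution hT f u₀ u₁, ?_, ?_⟩
  · exact WaveEq.eq_zero_of_B_eq_zero hT (norm_eq_zero.1 hv)
  · exact ⟨_, WaveEq.isRepresentative_state hT v,
      fun _ hw' => (WaveEq.isRepresentative_state hT v).eqOn hT hw'⟩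
  · rw [iInf_congr fun u => WaveEq.iSup_formB_div hT u.2, iInf_const]
  · rw [iSup_congr fun u => WaveEq.iSup_formB_div hT u.2, iSup_const]
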